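/- Conventions. Let $K$ be a complex Hilbert space, $\vartheta$ the flip of a tensor product of two Hilbert spaces, and $V$ a multiplicative unitary on $K\otimes K$, i.e. a unitary with $V_{12}V_{13}V_{23}=V_{23}V_{12}$. A corepresentation of $V$ on a Hilbert space $H$ is a unitary $W$ on $K\otimes H$ with $V_{12}W_{13}W_{23}=W_{23}V_{12}$; the arrows $(W,W')$ are the bounded operators $T:H\to H'$ with $(1\times T)W=W'(1\times T)$, the tensor product is $W\times W'=W_{12}W'_{13}$ on $K\otimes(H\otimes H')$, and $\iota(W)$ is the trivial corepresentation on $H$ (with $\iota(T)=T$). Let $\mathcal C(V)_V$ be the full tensor subcategory of corepresentations generated by $V$ (containing the tensor unit and closed under $\times$ and $\iota$), let $L,R$ be the functors of tensoring by $V$ on the left and on the right, and put $\xi_W=W^{-1}$, which makes $V$ a left regular object. A unitary natural transformation $\eta\in(R,R\iota)$, with components $\eta_W\in(W\times V,\iota(W)\times V)$, *defines a standard braided symmetry* if, for all objects $W,W'$ of $\mathcal C(V)_V$, (i) $\varepsilon_W:=\xi_W^{-1}\,\vartheta_{\iota(W),V}\,\eta_W$ is a natural transformation from $R$ to $L$ with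 $\varepsilon_{W\times W'}=(\varepsilon_W\times1_{W'})(1_W\times\varepsilon_{W'})$; (ii) $\eta_{W\times W'}=(\eta_W)_{13}\,(1_W\times\eta_{W'})$; (iii) $(\eta_W\times1_{\iota(W')})(1_W\times\xi_{W'})=(1_{\iota(W)}\times\xi_{W'})(\eta_W\times1_{W'})$. Let $V^d=\vartheta V^{-1}\vartheta$, and let $G_V$ be the set of unitaries $U$ on $K$ such that $TU^{\times r}=U^{\times s}T$ for all $r,s\ge 0$ and all $T\in(V^{\times r},V^{\times s})$. **Theorem 2.8.** Let $V$ be weakly irreducible, i.e. $(V,V)\cap(V^d,V^d)=\mathbb C I$. If $\eta,\tilde\eta\in(R,R\iota)$ are unitary natural transformations defining standard braided symmetries on $\mathcal C(V)_V$, then there is a unique unitary $U\in G_V$ with $\tilde\eta_V=(U\times 1_V)\,\eta_V$. Conversely, given any $U\in G_V$ and any such $\eta$, there is a unique unitary natural transformation $\tilde\eta\in(R,R\iota)$ defining a standard braided symmetry on $\mathcal C(V)_V$ with $\tilde\eta_V=(U\times1_V)\,\eta_V$. -/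

import Mathlib

open scoped TensorProduct

noncomputable section

universe u

namespace MulUnitary

/-! ### The Hilbert space tensor product -/

/-- The tensor product of two complex Hilbert spaces: the completion of the algebraic tensor
product with respect to the inner product `⟪x ⊗ y, x' ⊗ y'⟫ = ⟪x, x'⟫ ⟪y, y'⟫`. -/
def HTensor (H H' : Type u) [NormedAddCommGroup H] [InnerProductSpace ℂ H]
    [NormedAddCommGroup H'] [InnerProductSpace ℂ H'] : Type u :=
  UniformSpace.Completion (H ⊗[ℂ] H')

section Instances

variable (H H' : Type u) [NormedAddCommGroup H] [InnerProductSpace ℂ H]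
  [NormedAddCommGroup H'] [InnerProductSpace ℂ H']

instance : NormedAddCommGroup (HTensor H H') :=
  inferInstanceAs (NormedAddCommGroup (UniformSpace.Completion (H ⊗[ℂ] H')))

instance : InnerProductSpace ℂ (HTensor H H') :=
  inferInstanceAs (InnerProductSpace ℂ (UniformSpace.Completion (H ⊗[ℂ] H')))

instance : CompleteSpace (HTensor H H') :=
  inferInstanceAs (CompleteSpace (UniformSpace.Completion (H ⊗[ℂ] H')))

/-- The isometric inclusion of the algebraic tensor product. -/
def incl : H ⊗[ℂ] H' →ₗᵢ[ℂ] HTensor H H' :=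
  (UniformSpace.Completion.toComplₗᵢ : H ⊗[ℂ] H' →ₗᵢ[ℂ] UniformSpace.Completion (H ⊗[ℂ] H'))

theorem denseRange_incl : DenseRange (incl H H') :=
  UniformSpace.Completion.denseRange_coe

end Instances

section Tensor

variable {H H₁ H₂ H₃ H' H₁' H₂' H₃' : Type u}
  [NormedAddCommGroup H] [InnerProductSpace ℂ H]
  [NormedAddCommGroup H₁] [InnerProductSpace ℂ H₁]
  [NormedAddCommGroup H₂] [InnerProductSpace ℂ H₂]
  [NormedAddCommGroup H₃] [InnerProductSpace ℂ H₃]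
  [NormedAddCommGroup H'] [InnerProductSpace ℂ H']
  [NormedAddCommGroup H₁'] [InnerProductSpace ℂ H₁']
  [NormedAddCommGroup H₂'] [InnerProductSpace ℂ H₂']
  [NormedAddCommGroup H₃'] [InnerProductSpace ℂ H₃']

/-- The elementary tensor `x ⊗ y`. -/
def tmul (x : H) (y : H') : HTensor H H' := incl H H' (x ⊗ₜ[ℂ] y)

/-- The tensor product `S × T` of bounded operators. -/
def tmap (S : H →L[ℂ] H₁) (T : H' →L[ℂ] H₁') : HTensor H H' →L[ℂ] HTensor H₁ H₁' :=
  ((TensorProduct.mapL S T).completion :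
    UniformSpace.Completion (H ⊗[ℂ] H') →L[ℂ] UniformSpace.Completion (H₁ ⊗[ℂ] H₁'))

/-- Composition `B ∘ A` of unitary operators. -/
abbrev ucomp (B : H₁ ≃ₗᵢ[ℂ] H₂) (A : H ≃ₗᵢ[ℂ] H₁) : H ≃ₗᵢ[ℂ] H₂ := A.trans B

infixr:80 " ∘ᵤ " => ucomp

/-- The tensor product `A × B` of unitary operators. -/
def utensor (A : H ≃ₗᵢ[ℂ] H₁) (B : H' ≃ₗᵢ[ℂ] H₁') : HTensor H H' ≃ₗᵢ[ℂ] HTensor H₁ H₁' :=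
  (TensorProduct.congrIsometry A B).toLinearEquiv.extendOfIsometry
    (incl H H').toLinearMap (incl H₁ H₁').toLinearMap
    (denseRange_incl H H') (denseRange_incl H₁ H₁') (fun x =>
      ((incl H₁ H₁').norm_map _).trans
        (((TensorProduct.congrIsometry A B).norm_map x).trans ((incl H H').norm_map x).symm))

variable (H H') in
/-- The flip `ϑ : H ⊗ H' → H' ⊗ H`. -/
def flip : HTensor H H' ≃ₗᵢ[ℂ] HTensor H' H :=
  (TensorProduct.commIsometry ℂ H H').toLinearEquiv.extendOfIsometry
    (incl H H').toLinearMap (incl H' H).toLinearMap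
    (denseRange_incl H H') (denseRange_incl H' H) (fun x =>
      ((incl H' H).norm_map _).trans
        (((TensorProduct.commIsometry ℂ H H').norm_map x).trans ((incl H H').norm_map x).symm))

theorem tmul_add (x : H) (y y' : H') : tmul x (y + y') = tmul x y + tmul x y' := by
  rw [tmul, TensorProduct.tmul_add, map_add]; rfl

theorem add_tmul (x x' : H) (y : H') : tmul (x + x') y = tmul x y + tmul x' y := by
  rw [tmul, TensorProduct.add_tmul, map_add]; rfl

theorem tmul_smul (c : ℂ) (x : H) (y : H') : tmul x (c • y) = c • tmul x y := by
  rw [tmul, TensorProduct.tmul_smul, map_smul]; rfl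

theorem smul_tmul (c : ℂ) (x : H) (y : H') : tmul (c • x) y = c • tmul x y := by
  rw [tmul, ← TensorProduct.smul_tmul', map_smul]; rfl

theorem norm_tmul (x : H) (y : H') : ‖tmul x y‖ = ‖x‖ * ‖y‖ := by
  rw [tmul, LinearIsometry.norm_map, TensorProduct.norm_tmul]

theorem inner_tmul (x x' : H) (y y' : H') :
    inner ℂ (tmul x y) (tmul x' y') = inner ℂ x x' * inner ℂ y y' := by
  rw [tmul, tmul, LinearIsometry.inner_map_map, TensorProduct.inner_tmul]

/-- `x ↦ (y ↦ x ⊗ y)` as a bounded bilinear map. -/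
def tmulL : H →L[ℂ] H' →L[ℂ] HTensor H H' :=
  LinearMap.mkContinuous₂ (LinearMap.mk₂ ℂ tmul add_tmul smul_tmul tmul_add tmul_smul) 1
    (fun x y => by simp [norm_tmul])

@[simp] theorem tmulL_apply (x : H) (y : H') : tmulL x y = tmul x y := rfl

@[simp] theorem tmap_tmul (S : H →L[ℂ] H₁) (T : H' →L[ℂ] H₁') (x : H) (y : H') :
    tmap S T (tmul x y) = tmul (S x) (T y) :=
  ContinuousLinearMap.completion_apply_coe (TensorProduct.mapL S T) (x ⊗ₜ y)

@[simp] theorem utensor_tmul (A : H ≃ₗᵢ[ℂ] H₁) (B : H' ≃ₗᵢ[ℂ] H₁') (x : H) (y : H') :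
    utensor A B (tmul x y) = tmul (A x) (B y) :=
  LinearEquiv.extendOfIsometry_eq _ (incl H H').toLinearMap (incl H₁ H₁').toLinearMap
    (denseRange_incl H H') (denseRange_incl H₁ H₁') _ (x ⊗ₜ[ℂ] y)

@[simp] theorem flip_tmul (x : H) (y : H') : flip H H' (tmul x y) = tmul y x :=
  LinearEquiv.extendOfIsometry_eq _ (incl H H').toLinearMap (incl H' H).toLinearMap
    (denseRange_incl H H') (denseRange_incl H' H) _ (x ⊗ₜ[ℂ] y)

/-- A closed subspace containing all elementary tensors is everything. -/
theorem mem_of_tmul_mem (S : Submodule ℂ (HTensor H H')) (hS : IsClosed (S : Set (HTensor H H')))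
    (h : ∀ x y, tmul x y ∈ S) (z : HTensor H H') : z ∈ S := by
  refine (denseRange_incl H H').induction_on (p := fun z => z ∈ S) z hS fun a => ?_
  induction a using TensorProduct.induction_on with
  | zero => rw [map_zero]; exact S.zero_mem
  | tmul x y => exact h x y
  | add a b ha hb => rw [map_add]; exact S.add_mem ha hb

/-- Bounded operators on a tensor product are determined by elementary tensors. -/
theorem clm_ext {E : Type*} [NormedAddCommGroup E] [NormedSpace ℂ E]
    {S T : HTensor H H' →L[ℂ] E} (h : ∀ x y, S (tmul x y) = T (tmul x y)) : S = T := by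
  ext z
  exact mem_of_tmul_mem (LinearMap.eqLocus S.toLinearMap T.toLinearMap)
    (isClosed_eq S.continuous T.continuous) h z

/-- Comparison of the algebraic with the completed threefold tensor product. -/
def inclL (H₁ H₂ H₃ : Type u) [NormedAddCommGroup H₁] [InnerProductSpace ℂ H₁]
    [NormedAddCommGroup H₂] [InnerProductSpace ℂ H₂]
    [NormedAddCommGroup H₃] [InnerProductSpace ℂ H₃] :
    (H₁ ⊗[ℂ] H₂) ⊗[ℂ] H₃ →ₗᵢ[ℂ] HTensor (HTensor H₁ H₂) H₃ :=
  (incl (HTensor H₁ H₂) H₃).comp (TensorProduct.mapIsometry (incl H₁ H₂) LinearIsometry.id)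

/-- Comparison of the algebraic with the completed threefold tensor product. -/
def inclR (H₁ H₂ H₃ : Type u) [NormedAddCommGroup H₁] [InnerProductSpace ℂ H₁]
    [NormedAddCommGroup H₂] [InnerProductSpace ℂ H₂]
    [NormedAddCommGroup H₃] [InnerProductSpace ℂ H₃] :
    H₁ ⊗[ℂ] (H₂ ⊗[ℂ] H₃) →ₗᵢ[ℂ] HTensor H₁ (HTensor H₂ H₃) :=
  (incl H₁ (HTensor H₂ H₃)).comp (TensorProduct.mapIsometry LinearIsometry.id (incl H₂ H₃))

theorem denseRange_inclL : DenseRange (inclL H₁ H₂ H₃) := by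
  intro w
  refine mem_of_tmul_mem (LinearMap.range (inclL H₁ H₂ H₃).toLinearMap).topologicalClosure
    (Submodule.isClosed_topologicalClosure _) (fun z y => ?_) w
  refine (denseRange_incl H₁ H₂).induction_on
    (p := fun z => tmul z y ∈ (LinearMap.range (inclL H₁ H₂ H₃).toLinearMap).topologicalClosure) z
    (IsClosed.preimage (tmulL.flip y).continuous (Submodule.isClosed_topologicalClosure _))
    fun a => ?_
  exact Submodule.le_topologicalClosure _ ⟨a ⊗ₜ y, rfl⟩

theorem denseRange_inclR : DenseRange (inclR H₁ H₂ H₃) := by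
  intro w
  refine mem_of_tmul_mem (LinearMap.range (inclR H₁ H₂ H₃).toLinearMap).topologicalClosure
    (Submodule.isClosed_topologicalClosure _) (fun x z => ?_) w
  refine (denseRange_incl H₂ H₃).induction_on
    (p := fun z => tmul x z ∈ (LinearMap.range (inclR H₁ H₂ H₃).toLinearMap).topologicalClosure) z
    (IsClosed.preimage (tmulL x).continuous (Submodule.isClosed_topologicalClosure _))
    fun a => ?_
  exact Submodule.le_topologicalClosure _ ⟨x ⊗ₜ a, rfl⟩

variable (H₁ H₂ H₃) in
/-- The associativity unitary `(H₁ ⊗ H₂) ⊗ H₃ → H₁ ⊗ (H₂ ⊗ H₃)`. -/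
def assoc : HTensor (HTensor H₁ H₂) H₃ ≃ₗᵢ[ℂ] HTensor H₁ (HTensor H₂ H₃) :=
  (TensorProduct.assocIsometry ℂ H₁ H₂ H₃).toLinearEquiv.extendOfIsometry
    (inclL H₁ H₂ H₃).toLinearMap (inclR H₁ H₂ H₃).toLinearMap
    denseRange_inclL denseRange_inclR (fun x =>
      ((inclR H₁ H₂ H₃).norm_map _).trans
        (((TensorProduct.assocIsometry ℂ H₁ H₂ H₃).norm_map x).trans
          ((inclL H₁ H₂ H₃).norm_map x).symm))

@[simp] theorem assoc_tmul (x : H₁) (y : H₂) (z : H₃) :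
    assoc H₁ H₂ H₃ (tmul (tmul x y) z) = tmul x (tmul y z) :=
  LinearEquiv.extendOfIsometry_eq _ (inclL H₁ H₂ H₃).toLinearMap (inclR H₁ H₂ H₃).toLinearMap
    denseRange_inclL denseRange_inclR _ ((x ⊗ₜ[ℂ] y) ⊗ₜ[ℂ] z)

/-! ### Leg numbering

Threefold tensor products are bracketed as `H₁ ⊗ (H₂ ⊗ H₃)`. -/

/-- `A₁₂ = A × 1`. -/
def leg12 (A : HTensor H₁ H₂ ≃ₗᵢ[ℂ] HTensor H₁' H₂') (H₃ : Type u)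
    [NormedAddCommGroup H₃] [InnerProductSpace ℂ H₃] :
    HTensor H₁ (HTensor H₂ H₃) ≃ₗᵢ[ℂ] HTensor H₁' (HTensor H₂' H₃) :=
  assoc H₁' H₂' H₃ ∘ᵤ utensor A (.refl ℂ H₃) ∘ᵤ (assoc H₁ H₂ H₃).symm

/-- `A₂₃ = 1 × A`. -/
def leg23 (H₁ : Type u) [NormedAddCommGroup H₁] [InnerProductSpace ℂ H₁] (A : H ≃ₗᵢ[ℂ] H') :
    HTensor H₁ H ≃ₗᵢ[ℂ] HTensor H₁ H' :=
  utensor (.refl ℂ H₁) A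

/-- `A₁₃`, acting trivially on the second factor: `A₂₃` conjugated by the flip of the first two
factors. -/
def leg13 (A : HTensor H₁ H₃ ≃ₗᵢ[ℂ] HTensor H₁' H₃') (H₂ : Type u)
    [NormedAddCommGroup H₂] [InnerProductSpace ℂ H₂] :
    HTensor H₁ (HTensor H₂ H₃) ≃ₗᵢ[ℂ] HTensor H₁' (HTensor H₂ H₃') :=
  leg12 (flip H₂ H₁') H₃' ∘ᵤ leg23 H₂ A ∘ᵤ leg12 (flip H₁ H₂) H₃

theorem ext_tmul {A B : HTensor H H' ≃ₗᵢ[ℂ] H₁} (h : ∀ x y, A (tmul x y) = B (tmul x y)) :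
    A = B := by
  have : A.toContinuousLinearEquiv.toContinuousLinearMap =
    B.toContinuousLinearEquiv.toContinuousLinearMap := clm_ext h
  ext z
  exact congrArg (fun T : HTensor H H' →L[ℂ] H₁ => T z) this

theorem ext_tmul₃ {A B : HTensor H₁ (HTensor H₂ H₃) ≃ₗᵢ[ℂ] H}
    (h : ∀ x y z, A (tmul x (tmul y z)) = B (tmul x (tmul y z))) : A = B := by
  refine ext_tmul fun x w => ?_
  have : A.toContinuousLinearEquiv.toContinuousLinearMap ∘L tmulL x =
    B.toContinuousLinearEquiv.toContinuousLinearMap ∘L tmulL x := clm_ext (h x)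
  exact congrArg (fun T : HTensor H₂ H₃ →L[ℂ] H => T w) this

theorem ext_tmul₃' {A B : HTensor (HTensor H₁ H₂) H₃ ≃ₗᵢ[ℂ] H}
    (h : ∀ x y z, A (tmul (tmul x y) z) = B (tmul (tmul x y) z)) : A = B := by
  refine ext_tmul fun w z => ?_
  have : A.toContinuousLinearEquiv.toContinuousLinearMap ∘L tmulL.flip z =
    B.toContinuousLinearEquiv.toContinuousLinearMap ∘L tmulL.flip z := clm_ext fun x y => h x y z
  exact congrArg (fun T : HTensor H₁ H₂ →L[ℂ] H => T w) this

theorem ext_tmul₄ {A B : HTensor H₁ (HTensor (HTensor H₂ H₃) H') ≃ₗᵢ[ℂ] H}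
    (h : ∀ x y z w, A (tmul x (tmul (tmul y z) w)) = B (tmul x (tmul (tmul y z) w))) :
    A = B := by
  refine ext_tmul₃ fun x v w => ?_
  have : A.toContinuousLinearEquiv.toContinuousLinearMap ∘L tmulL x ∘L tmulL.flip w =
    B.toContinuousLinearEquiv.toContinuousLinearMap ∘L tmulL x ∘L tmulL.flip w :=
    clm_ext fun y z => h x y z w
  exact congrArg (fun T : HTensor H₂ H₃ →L[ℂ] H => T v) this

theorem ext_tmul₄' {A B : HTensor (HTensor H₁ H₂) (HTensor H₃ H') ≃ₗᵢ[ℂ] H}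
    (h : ∀ x y z w, A (tmul (tmul x y) (tmul z w)) = B (tmul (tmul x y) (tmul z w))) :
    A = B := by
  refine ext_tmul₃ fun v z w => ?_
  have : A.toContinuousLinearEquiv.toContinuousLinearMap ∘L tmulL.flip (tmul z w) =
    B.toContinuousLinearEquiv.toContinuousLinearMap ∘L tmulL.flip (tmul z w) :=
    clm_ext fun x y => h x y z w
  exact congrArg (fun T : HTensor H₁ H₂ →L[ℂ] H => T v) this

@[simp] theorem assoc_symm_tmul (x : H₁) (y : H₂) (z : H₃) :
    (assoc H₁ H₂ H₃).symm (tmul x (tmul y z)) = tmul (tmul x y) z := by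
  rw [LinearIsometryEquiv.symm_apply_eq, assoc_tmul]

@[simp] theorem leg23_tmul (A : H ≃ₗᵢ[ℂ] H') (x : H₁) (y : H) :
    leg23 H₁ A (tmul x y) = tmul x (A y) := by
  simp [leg23]

theorem leg12_tmul (A : HTensor H₁ H₂ ≃ₗᵢ[ℂ] HTensor H₁' H₂') (x : H₁) (y : H₂) (z : H₃) :
    leg12 A H₃ (tmul x (tmul y z)) = assoc H₁' H₂' H₃ (tmul (A (tmul x y)) z) := by
  simp [leg12]

@[simp] theorem leg12_flip_tmul (x : H₁) (y : H₂) (z : H₃) :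
    leg12 (flip H₁ H₂) H₃ (tmul x (tmul y z)) = tmul y (tmul x z) := by
  simp [leg12]

theorem utensor_trans (A : H ≃ₗᵢ[ℂ] H₁) (B : H₁ ≃ₗᵢ[ℂ] H₂) (A' : H' ≃ₗᵢ[ℂ] H₁')
    (B' : H₁' ≃ₗᵢ[ℂ] H₂') :
    utensor (B ∘ᵤ A) (B' ∘ᵤ A') = utensor B B' ∘ᵤ utensor A A' :=
  ext_tmul fun x y => by simp

theorem leg23_trans (A : H ≃ₗᵢ[ℂ] H₁) (B : H₁ ≃ₗᵢ[ℂ] H₂) :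
    leg23 H' (B ∘ᵤ A) = leg23 H' B ∘ᵤ leg23 H' A :=
  ext_tmul fun x y => by simp

theorem leg12_apply (A : HTensor H₁ H₂ ≃ₗᵢ[ℂ] HTensor H₁' H₂') (z) :
    leg12 A H₃ z = assoc H₁' H₂' H₃ (utensor A (.refl ℂ H₃) ((assoc H₁ H₂ H₃).symm z)) := rfl

theorem leg13_apply (A : HTensor H₁ H₃ ≃ₗᵢ[ℂ] HTensor H₁' H₃') (z) :
    leg13 A H₂ z = leg12 (flip H₂ H₁') H₃' (leg23 H₂ A (leg12 (flip H₁ H₂) H₃ z)) := rfl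

theorem leg23_leg23_apply (A : H ≃ₗᵢ[ℂ] H₁) (B : H₁ ≃ₗᵢ[ℂ] H₂) (z) :
    leg23 H' B (leg23 H' A z) = leg23 H' (B ∘ᵤ A) z := by
  rw [leg23_trans]; rfl

@[simp] theorem leg12_flip_flip (z) :
    leg12 (flip H₂ H₁) H₃ (leg12 (flip H₁ H₂) H₃ z) = z := by
  have h : leg12 (flip H₂ H₁) H₃ ∘ᵤ leg12 (flip H₁ H₂) H₃ = .refl ℂ _ :=
    ext_tmul₃ fun x y z => by simp
  exact DFunLike.congr_fun h z

theorem leg13_trans (A : HTensor H₁ H₃ ≃ₗᵢ[ℂ] HTensor H₁' H₃')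
    (B : HTensor H₁' H₃' ≃ₗᵢ[ℂ] HTensor H H') :
    leg13 (B ∘ᵤ A) H₂ = leg13 B H₂ ∘ᵤ leg13 A H₂ := by
  ext z
  simp [leg13_apply, leg23_trans]

theorem leg12_comm_leg23 (A : HTensor H₁ H₂ ≃ₗᵢ[ℂ] HTensor H₁' H₂') (B : H₃ ≃ₗᵢ[ℂ] H₃') (z) :
    leg12 A H₃' (leg23 H₁ (leg23 H₂ B) z) = leg23 H₁' (leg23 H₂' B) (leg12 A H₃ z) := by
  have h1 : (leg23 H₁ (leg23 H₂ B)).trans (assoc H₁ H₂ H₃').symm =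
      (assoc H₁ H₂ H₃).symm.trans (utensor (.refl ℂ _) B) := ext_tmul₃ fun x y z => by simp
  have h2 : (utensor (.refl ℂ _) B).trans (assoc H₁' H₂' H₃') =
      (assoc H₁' H₂' H₃).trans (leg23 H₁' (leg23 H₂' B)) := ext_tmul₃' fun x y z => by simp
  have h3 : (utensor (.refl ℂ _) B).trans (utensor A (.refl ℂ H₃')) =
      (utensor A (.refl ℂ H₃)).trans (utensor (.refl ℂ _) B) := ext_tmul fun x y => by simp
  have e1 := DFunLike.congr_fun h1 z
  have e3 := DFunLike.congr_fun h3 ((assoc H₁ H₂ H₃).symm z)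
  have e2 := DFunLike.congr_fun h2 (utensor A (.refl ℂ H₃) ((assoc H₁ H₂ H₃).symm z))
  simp only [LinearIsometryEquiv.trans_apply] at e1 e2 e3
  rw [leg12_apply, e1, e3, e2, leg12_apply]

/-- Moving the third of four factors to the front intertwines the two forms of `B₁₂`. -/
theorem shuffle_leg12 (B : HTensor H₁ H₂ ≃ₗᵢ[ℂ] HTensor H₁' H₂') (z) :
    leg12 (flip H₁' H) (HTensor H₂' H') (leg23 H₁' (leg12 (flip H₂' H) H')
      (leg12 B (HTensor H H') z)) =
    leg23 H (leg12 B H') (leg12 (flip H₁ H) (HTensor H₂ H')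
      (leg23 H₁ (leg12 (flip H₂ H) H') z)) := by
  have st : ∀ (G₁ G₂ : Type u) [NormedAddCommGroup G₁] [InnerProductSpace ℂ G₁]
      [NormedAddCommGroup G₂] [InnerProductSpace ℂ G₂]
      (v : HTensor (HTensor G₁ G₂) (HTensor H H')),
      leg12 (flip G₁ H) (HTensor G₂ H') (leg23 G₁ (leg12 (flip G₂ H) H')
        (assoc G₁ G₂ (HTensor H H') v)) =
      leg23 H (assoc G₁ G₂ H') (leg12 (flip (HTensor G₁ G₂) H) H' v) := by
    intro G₁ G₂ _ _ _ _ v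
    have h : ((assoc G₁ G₂ (HTensor H H')).trans (leg23 G₁ (leg12 (flip G₂ H) H'))).trans
        (leg12 (flip G₁ H) (HTensor G₂ H')) =
        (leg12 (flip (HTensor G₁ G₂) H) H').trans (leg23 H (assoc G₁ G₂ H')) :=
      ext_tmul₄' fun x y z w => by simp
    exact DFunLike.congr_fun h v
  have hn : ∀ v, leg12 (flip (HTensor H₁' H₂') H) H' (utensor B (.refl ℂ _) v) =
      leg23 H (utensor B (.refl ℂ _)) (leg12 (flip (HTensor H₁ H₂) H) H' v) := by
    intro v
    have h : (utensor B (.refl ℂ _)).trans (leg12 (flip (HTensor H₁' H₂') H) H') =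
      (leg12 (flip (HTensor H₁ H₂) H) H').trans (leg23 H (utensor B (.refl ℂ _))) :=
      ext_tmul₃ fun x y z => by simp
    exact DFunLike.congr_fun h v
  obtain ⟨v, rfl⟩ := (assoc H₁ H₂ (HTensor H H')).surjective z
  rw [leg12_apply B, LinearIsometryEquiv.symm_apply_apply, st, hn, st, leg23_leg23_apply,
    leg23_leg23_apply]
  congr 2
  ext z
  simp [leg12_apply]

/-- Bracketing the first three of four factors together intertwines the two forms of `B₁₂`. -/
theorem assoc_leg12 (B : HTensor H₁ H₂ ≃ₗᵢ[ℂ] HTensor H₁' H₂')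
    (z : HTensor (HTensor H₁ (HTensor H₂ H)) H') :
    leg12 B (HTensor H H') (leg23 H₁ (assoc H₂ H H') (assoc H₁ (HTensor H₂ H) H' z)) =
    leg23 H₁' (assoc H₂' H H') (assoc H₁' (HTensor H₂' H) H'
      (utensor (leg12 B H) (.refl ℂ H') z)) := by
  have st : ∀ (G₁ G₂ : Type u) [NormedAddCommGroup G₁] [InnerProductSpace ℂ G₁]
      [NormedAddCommGroup G₂] [InnerProductSpace ℂ G₂]
      (v : HTensor (HTensor (HTensor G₁ G₂) H) H'),
      leg23 G₁ (assoc G₂ H H') (assoc G₁ (HTensor G₂ H) H'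
        (utensor (assoc G₁ G₂ H) (.refl ℂ H') v)) =
      assoc G₁ G₂ (HTensor H H') (assoc (HTensor G₁ G₂) H H' v) := by
    intro G₁ G₂ _ _ _ _ v
    obtain ⟨v, rfl⟩ := (assoc (HTensor G₁ G₂) H H').symm.surjective v
    have h : (((assoc (HTensor G₁ G₂) H H').symm.trans
        (utensor (assoc G₁ G₂ H) (.refl ℂ H'))).trans (assoc G₁ (HTensor G₂ H) H')).trans
          (leg23 G₁ (assoc G₂ H H')) = assoc G₁ G₂ (HTensor H H') :=
      ext_tmul₄' fun x y z w => by simp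
    simpa using DFunLike.congr_fun h v
  have hn : ∀ v, assoc (HTensor H₁' H₂') H H' (utensor (utensor B (.refl ℂ H)) (.refl ℂ H') v) =
      utensor B (.refl ℂ _) (assoc (HTensor H₁ H₂) H H' v) := by
    intro v
    have h : (utensor (utensor B (.refl ℂ H)) (.refl ℂ H')).trans (assoc (HTensor H₁' H₂') H H') =
      (assoc (HTensor H₁ H₂) H H').trans (utensor B (.refl ℂ _)) :=
      ext_tmul₃' fun x y z => by simp
    exact DFunLike.congr_fun h v
  obtain ⟨v, rfl⟩ := (utensor (assoc H₁ H₂ H) (.refl ℂ H')).surjective z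
  have e : utensor (leg12 B H) (.refl ℂ H') (utensor (assoc H₁ H₂ H) (.refl ℂ H') v) =
      utensor (assoc H₁' H₂' H) (.refl ℂ H') (utensor (utensor B (.refl ℂ H)) (.refl ℂ H') v) := by
    have h : (utensor (assoc H₁ H₂ H) (.refl ℂ H')).trans (utensor (leg12 B H) (.refl ℂ H')) =
        (utensor (utensor B (.refl ℂ H)) (.refl ℂ H')).trans
          (utensor (assoc H₁' H₂' H) (.refl ℂ H')) :=
      ext_tmul fun x y => by simp [leg12_apply]
    exact DFunLike.congr_fun h v
  rw [st, leg12_apply, LinearIsometryEquiv.symm_apply_apply, e, st, hn]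

theorem assoc_leg23 (W : HTensor H₂ H ≃ₗᵢ[ℂ] HTensor H₂ H)
    (z : HTensor (HTensor H₁ (HTensor H₂ H)) H') :
    leg23 H₁ (leg12 W H') (leg23 H₁ (assoc H₂ H H') (assoc H₁ (HTensor H₂ H) H' z)) =
    leg23 H₁ (assoc H₂ H H') (assoc H₁ (HTensor H₂ H) H'
      (utensor (leg23 H₁ W) (.refl ℂ H') z)) := by
  have h : ((assoc H₁ (HTensor H₂ H) H').trans (leg23 H₁ (assoc H₂ H H'))).trans
      (leg23 H₁ (leg12 W H')) = ((utensor (leg23 H₁ W) (.refl ℂ H')).trans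
        (assoc H₁ (HTensor H₂ H) H')).trans (leg23 H₁ (assoc H₂ H H')) :=
    ext_tmul₃' fun x y z => by simp [leg12_apply]
  exact DFunLike.congr_fun h z

end Tensor

/-! ### Multiplicative unitaries and corepresentations -/

section Corep

variable {K : Type u} [NormedAddCommGroup K] [InnerProductSpace ℂ K]
  {H H' : Type u} [NormedAddCommGroup H] [InnerProductSpace ℂ H]
  [NormedAddCommGroup H'] [InnerProductSpace ℂ H']

/-- The corepresentation equation `V₁₂ W₁₃ W₂₃ = W₂₃ V₁₂` on `K ⊗ (K ⊗ H)`. -/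
def IsCorep (V : HTensor K K ≃ₗᵢ[ℂ] HTensor K K) (W : HTensor K H ≃ₗᵢ[ℂ] HTensor K H) : Prop :=
  leg12 V H ∘ᵤ leg13 W K ∘ᵤ leg23 K W = leg23 K W ∘ᵤ leg12 V H

/-- The unitary `W × W' = W₁₂ W'₁₃` on `K ⊗ (H ⊗ H')`. -/
def corepTensor (W : HTensor K H ≃ₗᵢ[ℂ] HTensor K H) (W' : HTensor K H' ≃ₗᵢ[ℂ] HTensor K H') :
    HTensor K (HTensor H H') ≃ₗᵢ[ℂ] HTensor K (HTensor H H') :=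
  leg12 W H' ∘ᵤ leg13 W' H

theorem isCorep_refl (V : HTensor K K ≃ₗᵢ[ℂ] HTensor K K) :
    IsCorep V (.refl ℂ (HTensor K H)) := by
  have h23 : leg23 K (.refl ℂ (HTensor K H)) = .refl ℂ _ := ext_tmul fun x y => by simp
  have h13 : leg13 (.refl ℂ (HTensor K H)) K = .refl ℂ _ := by
    ext z; simp [leg13_apply, h23]
  ext z
  simp [h23, h13]

theorem IsCorep.tensor {V : HTensor K K ≃ₗᵢ[ℂ] HTensor K K} {W : HTensor K H ≃ₗᵢ[ℂ] HTensor K H}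
    {W' : HTensor K H' ≃ₗᵢ[ℂ] HTensor K H'} (hW : IsCorep V W) (hW' : IsCorep V W') :
    IsCorep V (corepTensor W W') := by
  have f1 : ∀ z, leg12 V (HTensor H H') (leg13 (leg12 W H') K (leg23 K (leg12 W H') z)) =
      leg23 K (leg12 W H') (leg12 V (HTensor H H') z) := by
    intro z
    obtain ⟨z, rfl⟩ := (leg23 K (assoc K H H')).surjective z
    obtain ⟨z, rfl⟩ := (assoc K (HTensor K H) H').surjective z
    simp only [leg13_apply, assoc_leg12, assoc_leg23]
    have h : ((utensor (leg23 K W) (.refl ℂ H')).trans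
        (utensor (leg13 W K) (.refl ℂ H'))).trans (utensor (leg12 V H) (.refl ℂ H')) =
        (utensor (leg12 V H) (.refl ℂ H')).trans (utensor (leg23 K W) (.refl ℂ H')) :=
      ext_tmul fun x y => by
        simpa using congrArg (fun t => tmul t y) (DFunLike.congr_fun hW x)
    have h13 : ∀ t, utensor (leg13 W K) (.refl ℂ H') t = utensor (leg12 (flip K K) H) (.refl ℂ H')
        (utensor (leg23 K W) (.refl ℂ H') (utensor (leg12 (flip K K) H) (.refl ℂ H') t)) := by
      intro t
      have h : utensor (leg13 W K) (.refl ℂ H') = ((utensor (leg12 (flip K K) H) (.refl ℂ H')).trans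
        (utensor (leg23 K W) (.refl ℂ H'))).trans (utensor (leg12 (flip K K) H) (.refl ℂ H')) :=
        ext_tmul fun x y => by simp [leg13_apply]
      exact DFunLike.congr_fun h t
    have := DFunLike.congr_fun h z
    simp only [LinearIsometryEquiv.trans_apply, h13] at this
    rw [this]
  have hδ : ∀ (X : HTensor K H' ≃ₗᵢ[ℂ] HTensor K H') (z),
      leg12 (flip K H) (HTensor K H') (leg23 K (leg12 (flip K H) H') (leg23 K (leg13 X H) z)) =
      leg23 H (leg23 K X) (leg12 (flip K H) (HTensor K H')
        (leg23 K (leg12 (flip K H) H') z)) := by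
    intro X z
    have h : leg12 (flip K H) H' ∘ᵤ leg13 X H = leg23 H X ∘ᵤ leg12 (flip K H) H' := by
      ext t
      simp [leg13_apply]
    rw [← leg12_comm_leg23, leg23_leg23_apply, leg23_leg23_apply, h]
  have f2 : ∀ z, leg12 V (HTensor H H') (leg13 (leg13 W' H) K (leg23 K (leg13 W' H) z)) =
      leg23 K (leg13 W' H) (leg12 V (HTensor H H') z) := by
    intro z
    apply (leg23 K (leg12 (flip K H) H')).injective
    apply (leg12 (flip K H) (HTensor K H')).injective
    simp only [leg13_apply (A := leg13 W' H), shuffle_leg12, hδ]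
    simp only [leg23_leg23_apply]
    congr 1
    exact congrArg (leg23 H) hW'
  have f3 : ∀ z, leg13 (leg13 W' H) K (leg23 K (leg12 W H') z) =
      leg23 K (leg12 W H') (leg13 (leg13 W' H) K z) := by
    intro z
    obtain ⟨z, rfl⟩ := (leg23 K (assoc K H H')).surjective z
    have g1 : ∀ t, leg23 K (leg12 W H') (leg23 K (assoc K H H') t) =
        leg23 K (assoc K H H') (leg23 K (utensor W (.refl ℂ H')) t) := by
      intro t
      have h : leg12 W H' ∘ᵤ assoc K H H' = assoc K H H' ∘ᵤ utensor W (.refl ℂ H') := by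
        ext t; simp [leg12_apply]
      rw [leg23_leg23_apply, leg23_leg23_apply, h]
    have g2 : ∀ t, leg13 (leg13 W' H) K (leg23 K (assoc K H H') t) =
        leg23 K (assoc K H H') (leg13 W' (HTensor K H) t) := by
      intro t
      have s1 : ∀ t, leg23 K (leg12 (flip K H) H') (leg12 (flip K K) (HTensor H H')
          (leg23 K (assoc K H H') t)) =
          assoc K H (HTensor K H') (leg12 (flip K (HTensor K H)) H' t) := by
        intro t
        have h : leg23 K (leg12 (flip K H) H') ∘ᵤ leg12 (flip K K) (HTensor H H') ∘ᵤ
            leg23 K (assoc K H H') =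
            assoc K H (HTensor K H') ∘ᵤ leg12 (flip K (HTensor K H)) H' :=
          ext_tmul₄ fun x y z w => by simp
        exact DFunLike.congr_fun h t
      have s2 : ∀ t, leg12 (flip K K) (HTensor H H') (leg23 K (leg12 (flip H K) H')
          (assoc K H (HTensor K H') t)) =
          leg23 K (assoc K H H') (leg12 (flip (HTensor K H) K) H' t) := by
        intro t
        have h : leg12 (flip K K) (HTensor H H') ∘ᵤ leg23 K (leg12 (flip H K) H') ∘ᵤ
            assoc K H (HTensor K H') =
            leg23 K (assoc K H H') ∘ᵤ leg12 (flip (HTensor K H) K) H' :=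
          ext_tmul₄' fun x y z w => by simp
        exact DFunLike.congr_fun h t
      have s3 : ∀ t, leg23 K (leg23 H W') (assoc K H (HTensor K H') t) =
          assoc K H (HTensor K H') (leg23 (HTensor K H) W' t) := by
        intro t
        have h : leg23 K (leg23 H W') ∘ᵤ assoc K H (HTensor K H') =
          assoc K H (HTensor K H') ∘ᵤ leg23 (HTensor K H) W' :=
          ext_tmul₃' fun x y z => by simp
        exact DFunLike.congr_fun h t
      have s4 : leg13 W' H = leg12 (flip H K) H' ∘ᵤ leg23 H W' ∘ᵤ leg12 (flip K H) H' := rfl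
      rw [leg13_apply, s4, leg23_trans, leg23_trans, leg13_apply W', ← s2, ← s3, ← s1]
      rfl
    have g3 : ∀ t, leg13 W' (HTensor K H) (leg23 K (utensor W (.refl ℂ H')) t) =
        leg23 K (utensor W (.refl ℂ H')) (leg13 W' (HTensor K H) t) := by
      intro t
      have r1 : leg12 (flip K (HTensor K H)) H' ∘ᵤ leg23 K (utensor W (.refl ℂ H')) =
          utensor W (.refl ℂ _) ∘ᵤ leg12 (flip K (HTensor K H)) H' :=
        ext_tmul₃ fun x y z => by simp
      have r2 : leg23 (HTensor K H) W' ∘ᵤ utensor W (.refl ℂ _) =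
          utensor W (.refl ℂ _) ∘ᵤ leg23 (HTensor K H) W' :=
        ext_tmul fun x y => by simp
      have r3 : leg12 (flip (HTensor K H) K) H' ∘ᵤ utensor W (.refl ℂ _) =
          leg23 K (utensor W (.refl ℂ H')) ∘ᵤ leg12 (flip (HTensor K H) K) H' :=
        ext_tmul₃ fun x y z => by simp
      have e1 := DFunLike.congr_fun r1 t
      have e2 := DFunLike.congr_fun r2 (leg12 (flip K (HTensor K H)) H' t)
      have e3 := DFunLike.congr_fun r3 (leg23 (HTensor K H) W'
        (leg12 (flip K (HTensor K H)) H' t))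
      simp only [LinearIsometryEquiv.trans_apply] at e1 e2 e3
      rw [leg13_apply, leg13_apply, e1, e2, e3]
    rw [g1, g2, g3, g2, g1]
  ext z
  change leg12 V (HTensor H H') (leg13 (leg12 W H' ∘ᵤ leg13 W' H) K
    (leg23 K (leg12 W H' ∘ᵤ leg13 W' H) z)) =
    leg23 K (leg12 W H' ∘ᵤ leg13 W' H) (leg12 V (HTensor H H') z)
  rw [leg13_trans, leg23_trans]
  simp only [LinearIsometryEquiv.trans_apply]
  rw [f3, f1, f2]

/-- `T : H → H'` intertwines `W` and `W'`, i.e. `T ∈ (W, W')`: `(1 × T) W = W' (1 × T)`. -/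
def IsIntertwiner (W : HTensor K H ≃ₗᵢ[ℂ] HTensor K H) (W' : HTensor K H' ≃ₗᵢ[ℂ] HTensor K H')
    (T : H →L[ℂ] H') : Prop :=
  ∀ z, tmap (.id ℂ K) T (W z) = W' (tmap (.id ℂ K) T z)

end Corep

/-- A multiplicative unitary on the Hilbert space `K`: a unitary `V` on `K ⊗ K` such that
`V₁₂ V₁₃ V₂₃ = V₂₃ V₁₂`. -/
structure MultUnitary (K : Type u) [NormedAddCommGroup K] [InnerProductSpace ℂ K] where
  /-- The unitary operator on `K ⊗ K`. -/
  op : HTensor K K ≃ₗᵢ[ℂ] HTensor K K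
  mult : leg12 op K ∘ᵤ leg13 op K ∘ᵤ leg23 K op = leg23 K op ∘ᵤ leg12 op K

section Category

variable {K : Type u} [NormedAddCommGroup K] [InnerProductSpace ℂ K]

/-- A corepresentation of `V` on a Hilbert space, i.e. an object of `C(V)`. -/
structure Corep (V : MultUnitary K) where
  /-- The underlying Hilbert space `H`. -/
  space : Type u
  [normed : NormedAddCommGroup space]
  [inner : InnerProductSpace ℂ space]
  [complete : CompleteSpace space]
  /-- The unitary operator on `K ⊗ H`. -/
  op : HTensor K space ≃ₗᵢ[ℂ] HTensor K space
  isCorep : IsCorep V.op op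

attribute [instance] Corep.normed Corep.inner Corep.complete

/-- The tensor unit `ℂ` of `C(V)`, realized as a one-dimensional Hilbert space in the universe
of `K`. -/
@[reducible] def Corep.one (V : MultUnitary K) : Corep V where
  space := EuclideanSpace ℂ PUnit.{u + 1}
  op := .refl ℂ _
  isCorep := isCorep_refl _

/-- `V` as a corepresentation of itself: the regular corepresentation. -/
@[reducible] def Corep.reg [CompleteSpace K] (V : MultUnitary K) : Corep V where
  space := K
  op := V.op
  isCorep := V.mult

/-- The trivial corepresentation `ι(W)` on the Hilbert space of `W`. -/
@[reducible] def Corep.triv {V : MultUnitary K} (W : Corep V) : Corep V where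
  space := W.space
  op := .refl ℂ _
  isCorep := isCorep_refl _

/-- The tensor product `W × W' = W₁₂ W'₁₃` of corepresentations. -/
@[reducible] def Corep.tensor {V : MultUnitary K} (W W' : Corep V) : Corep V where
  space := HTensor W.space W'.space
  op := corepTensor W.op W'.op
  isCorep := W.isCorep.tensor W'.isCorep

/-- Names for the objects of `C(V)_V`, the full tensor subcategory of `C(V)` generated by `V`:
it contains the tensor unit and `V` and is closed under the endofunctor `ι` and under `×`. -/
inductive Word : Type
  | one : Word
  | reg : Word
  | triv : Word → Word
  | tensor : Word → Word → Word

variable [CompleteSpace K]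

/-- The corepresentation named by a word. -/
@[reducible] def Word.obj (V : MultUnitary K) : Word → Corep V
  | .one => Corep.one V
  | .reg => Corep.reg V
  | .triv w => (w.obj V).triv
  | .tensor w w' => (w.obj V).tensor (w'.obj V)

/-- The Hilbert space of the corepresentation named by a word. -/
abbrev Word.space (w : Word) (V : MultUnitary K) : Type u := (w.obj V).space

/-- The arrows `(W, W')` of `C(V)_V`; the subcategory is full. -/
def Word.IsHom (V : MultUnitary K) (w w' : Word) (T : w.space V →L[ℂ] w'.space V) : Prop :=
  IsIntertwiner (w.obj V).op (w'.obj V).op T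

/-- A bounded operator viewed from a unitary one. -/
abbrev toCLM {H H' : Type u} [NormedAddCommGroup H] [InnerProductSpace ℂ H]
    [NormedAddCommGroup H'] [InnerProductSpace ℂ H'] (A : H ≃ₗᵢ[ℂ] H') : H →L[ℂ] H' :=
  A.toContinuousLinearEquiv.toContinuousLinearMap

/-- A unitary natural transformation `η ∈ (R, Rι)` on `C(V)_V`, where `R` is the functor
`W ↦ W × V`, `T ↦ T × 1_V`. -/
@[ext] structure NatTransR (V : MultUnitary K) where
  /-- The unitary component `η_W`. -/
  app : ∀ w : Word, HTensor (w.space V) K ≃ₗᵢ[ℂ] HTensor (w.space V) K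
  /-- `η_W ∈ (W × V, ι(W) × V)`. -/
  hom : ∀ w : Word, Word.IsHom V (w.tensor .reg) (w.triv.tensor .reg) (toCLM (app w))
  /-- `(ι(T) × 1_V) η_W = η_{W'} (T × 1_V)` for `T ∈ (W, W')`. -/
  natural : ∀ (w w' : Word) (T : w.space V →L[ℂ] w'.space V), Word.IsHom V w w' T →
    ∀ z, tmap T (.id ℂ K) (app w z) = app w' (tmap T (.id ℂ K) z)

namespace NatTransR

variable {V : MultUnitary K} (η : NatTransR V)

/-- The value `η_V`, a unitary on `K ⊗ K`. -/
def atV : HTensor K K ≃ₗᵢ[ℂ] HTensor K K := η.app .reg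

variable (V) in
/-- The natural transformation `ξ_W = W⁻¹ ∈ (V × W, V × ι(W))` from `L = V × ·` to `Lι`. It makes
`V` a left regular object: the intertwining property is the corepresentation equation, naturality
is the definition of an intertwiner, and
`ξ_{W × W'} = (ξ_{W'})₁₃ (ξ_W × 1_{W'})` is the definition of `W × W'`. -/
def xi (w : Word) : HTensor K (w.space V) ≃ₗᵢ[ℂ] HTensor K (w.space V) :=
  (w.obj V).op.symm

/-- `ε_W = ξ_W⁻¹ θ_W η_W : W × V → V × W`, where `θ_W = ϑ_{ι(W), V}` is the flip. -/
def eps (w : Word) : HTensor (w.space V) K ≃ₗᵢ[ℂ] HTensor K (w.space V) :=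
  (xi V w).symm ∘ᵤ flip (w.space V) K ∘ᵤ η.app w

/-- `ε` is a braided symmetry relative to `V`: a (unitary) natural transformation from
`R = · × V` to `L = V × ·` such that `ε_{W × W'} = (ε_W × 1_{W'}) (1_W × ε_{W'})`. -/
structure IsBraidedSymmetry (V : MultUnitary K)
    (ε : ∀ w : Word, HTensor (w.space V) K ≃ₗᵢ[ℂ] HTensor K (w.space V)) : Prop where
  hom : ∀ w : Word, Word.IsHom V (w.tensor .reg) (Word.reg.tensor w) (toCLM (ε w))
  natural : ∀ (w w' : Word) (T : w.space V →L[ℂ] w'.space V), Word.IsHom V w w' T →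
    ∀ z, tmap (.id ℂ K) T (ε w z) = ε w' (tmap T (.id ℂ K) z)
  tensor : ∀ w w' : Word, ε (w.tensor w') =
    leg12 (ε w) (w'.space V) ∘ᵤ leg23 (w.space V) (ε w') ∘ᵤ assoc (w.space V) (w'.space V) K

/-- `(V, η)` is a right regular object: `η_{W × W'} = (η_W)₁₃ (1_W × η_{W'})`. -/
def IsRightRegular : Prop :=
  ∀ w w' : Word, assoc (w.space V) (w'.space V) K ∘ᵤ η.app (w.tensor w') =
    leg13 (η.app w) (w'.space V) ∘ᵤ leg23 (w.space V) (η.app w') ∘ᵤ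
      assoc (w.space V) (w'.space V) K

/-- `(η_W × 1_{ι(W')}) (1_W × ξ_{W'}) = (1_{ι(W)} × ξ_{W'}) (η_W × 1_{W'})`
on `W × V × W'`. -/
def IsCoherent : Prop :=
  ∀ w w' : Word, leg12 (η.app w) (w'.space V) ∘ᵤ leg23 (w.space V) (xi V w') =
    leg23 (w.space V) (xi V w') ∘ᵤ leg12 (η.app w) (w'.space V)

/-- `η` defines a standard braided symmetry: `ε = ξ⁻¹ θ η` is a braided symmetry relative to the
left regular object `(ξ, V)`, `(V, η)` is right regular, and `η` and `ξ` are coherent. -/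
structure DefinesStandard : Prop where
  braided : IsBraidedSymmetry V η.eps
  rightRegular : η.IsRightRegular
  coherent : η.IsCoherent

end NatTransR

namespace MultUnitary

/-- The dual `V^d = ϑ V⁻¹ ϑ`. -/
def dual (V : MultUnitary K) : HTensor K K ≃ₗᵢ[ℂ] HTensor K K :=
  flip K K ∘ᵤ V.op.symm ∘ᵤ flip K K

/-- `V` is weakly irreducible: `(V, V) ∩ (V^d, V^d) = ℂ I`. -/
def WeaklyIrreducible (V : MultUnitary K) : Prop :=
  {T : K →L[ℂ] K | IsIntertwiner V.op V.op T} ∩ {T | IsIntertwiner V.dual V.dual T} =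
    {T | ∃ c : ℂ, T = c • ContinuousLinearMap.id ℂ K}

/-- The tensor power `V^{× r}`; `V^{× 0}` is the tensor unit. -/
def power : ℕ → Word
  | 0 => .one
  | r + 1 => (power r).tensor .reg

/-- The operator `U^{× r}` on the Hilbert space of `V^{× r}`. -/
def upower (V : MultUnitary K) (U : K ≃ₗᵢ[ℂ] K) :
    ∀ r : ℕ, (power r).space V ≃ₗᵢ[ℂ] (power r).space V
  | 0 => .refl ℂ _
  | r + 1 => utensor (upower V U r) U

/-- `G_V`: the unitaries `U` on `K` with `T U^{× r} = U^{× s} T` for all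
`T ∈ (V^{× r}, V^{× s})`. -/
def G (V : MultUnitary K) : Set (K ≃ₗᵢ[ℂ] K) :=
  {U | ∀ (r s : ℕ) (T : (power r).space V →L[ℂ] (power s).space V),
    Word.IsHom V (power r) (power s) T → ∀ z, T (V.upower U r z) = V.upower U s (T z)}

end MultUnitary

end Category

end MulUnitary

end

noncomputable section

namespace MulUnitary

/-! ### Bounded operators on tensor products -/

section Operators

variable {H H₁ H₂ H₃ H' H₁' H₂' H₃' : Type u}
  [NormedAddCommGroup H] [InnerProductSpace ℂ H]
  [NormedAddCommGroup H₁] [InnerProductSpace ℂ H₁]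
  [NormedAddCommGroup H₂] [InnerProductSpace ℂ H₂]
  [NormedAddCommGroup H₃] [InnerProductSpace ℂ H₃]
  [NormedAddCommGroup H'] [InnerProductSpace ℂ H']
  [NormedAddCommGroup H₁'] [InnerProductSpace ℂ H₁']
  [NormedAddCommGroup H₂'] [InnerProductSpace ℂ H₂']
  [NormedAddCommGroup H₃'] [InnerProductSpace ℂ H₃']

/-! Let `η`, `η'` define standard braided symmetries and put X_W = η'_W η_W⁻¹, a unitary on H_W ⊗ K.
It is an arrow from ι(W) × V to itself, and ι(W) does not touch the leg H_W, so every slice (⟨x'| ×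
1) X_W (|x⟩ × 1) lies in (V, V). Coherence with W' = V says that X_W × 1 commutes with V⁻¹ on the
last two legs; slicing the first leg puts the same operators in (V^d, V^d). Weak irreducibility
makes all slices scalar, which forces X_W = U_W × 1 (`exists_app_eq_utensor`).

The unitaries U_W inherit the structure of the category. They commute with all arrows by naturality,
and right regularity gives U_{W × W'} = U_W × U_{W'}. Naturality and multiplicativity make U trivial
on the tensor unit, and hence on trivial corepresentations, all of whose vectors are arrows from the
unit. So the whole family is generated by U = U_V, and naturality on tensor powers says U ∈ G_V
(`exists_app_eq_wordUnitary`).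

Conversely, U ∈ G_V extends multiplicatively to every object by `wordUnitary`. The point to prove is
that the extension commutes with all arrows, while membership in G_V only speaks of arrows between
tensor powers of V. This is `wordUnitary_natural`: arrows from tensor powers fill every object
(`mem_of_power_mem`), and adjoints of arrows are arrows. Then (U_W × 1) η_W is again standard; the
conditions on ε need no separate check, since they follow from right regularity and coherence
(`eps_tensor`).

Uniqueness holds because U × 1 on K ⊗ K determines U, and U determines all U_W. The case K = 0 is
treated apart, since cancelling the second factor needs a nonzero vector of K. -/

theorem clm_ext₃ {E : Type*} [NormedAddCommGroup E] [NormedSpace ℂ E]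
    {S T : HTensor H₁ (HTensor H₂ H₃) →L[ℂ] E}
    (h : ∀ x y z, S (tmul x (tmul y z)) = T (tmul x (tmul y z))) : S = T := by
  refine clm_ext fun x w => ?_
  have : S ∘L tmulL x = T ∘L tmulL x := clm_ext (h x)
  exact congrArg (fun T : HTensor H₂ H₃ →L[ℂ] E => T w) this

theorem clm_ext₃' {E : Type*} [NormedAddCommGroup E] [NormedSpace ℂ E]
    {S T : HTensor (HTensor H₁ H₂) H₃ →L[ℂ] E}
    (h : ∀ x y z, S (tmul (tmul x y) z) = T (tmul (tmul x y) z)) : S = T := by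
  refine clm_ext fun w z => ?_
  have : S ∘L tmulL.flip z = T ∘L tmulL.flip z := clm_ext fun x y => h x y z
  exact congrArg (fun T : HTensor H₁ H₂ →L[ℂ] E => T w) this

@[simp] theorem toCLM_apply (A : H ≃ₗᵢ[ℂ] H₁) (x : H) : toCLM A x = A x := rfl

@[simp] theorem tmap_id : tmap (.id ℂ H) (.id ℂ H') = .id ℂ (HTensor H H') :=
  clm_ext fun x y => by simp

theorem tmap_comp (S : H →L[ℂ] H₁) (T : H' →L[ℂ] H₁') (S' : H₁ →L[ℂ] H₂) (T' : H₁' →L[ℂ] H₂') :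
    tmap (S' ∘L S) (T' ∘L T) = tmap S' T' ∘L tmap S T :=
  clm_ext fun x y => by simp

theorem tmap_id_toCLM (A : H ≃ₗᵢ[ℂ] H₁) (z : HTensor H' H) :
    tmap (.id ℂ H') (toCLM A) z = leg23 H' A z := by
  have : tmap (.id ℂ H') (toCLM A) = toCLM (leg23 H' A) := clm_ext fun x y => by simp
  exact DFunLike.congr_fun this z

/-- Once the associator is removed, the operator acts on the first two legs and S on the third, so
only the intertwining property of T is used. With its analogue for legs 1 and 3 it makes × a functor
on arrows. -/
theorem tmap_tmap_leg12 (W : HTensor H₁ H₂ ≃ₗᵢ[ℂ] HTensor H₁ H₂)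
    (W' : HTensor H₁ H₂' ≃ₗᵢ[ℂ] HTensor H₁ H₂') (T : H₂ →L[ℂ] H₂') (S : H₃ →L[ℂ] H₃')
    (h : ∀ z, tmap (.id ℂ H₁) T (W z) = W' (tmap (.id ℂ H₁) T z)) (z) :
    tmap (.id ℂ H₁) (tmap T S) (leg12 W H₃ z) =
      leg12 W' H₃' (tmap (.id ℂ H₁) (tmap T S) z) := by
  have hn : ∀ v, tmap (.id ℂ H₁) (tmap T S) (assoc H₁ H₂ H₃ v) =
      assoc H₁ H₂' H₃' (tmap (tmap (.id ℂ H₁) T) S v) := by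
    intro v
    have : tmap (.id ℂ H₁) (tmap T S) ∘L toCLM (assoc H₁ H₂ H₃) =
      toCLM (assoc H₁ H₂' H₃') ∘L tmap (tmap (.id ℂ H₁) T) S := clm_ext₃' fun x y z => by simp
    exact DFunLike.congr_fun this v
  obtain ⟨v, rfl⟩ := (assoc H₁ H₂ H₃).surjective z
  have hv : tmap (tmap (.id ℂ H₁) T) S (utensor W (.refl ℂ H₃) v) =
      utensor W' (.refl ℂ H₃') (tmap (tmap (.id ℂ H₁) T) S v) := by
    have : tmap (tmap (.id ℂ H₁) T) S ∘L toCLM (utensor W (.refl ℂ H₃)) =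
      toCLM (utensor W' (.refl ℂ H₃')) ∘L tmap (tmap (.id ℂ H₁) T) S :=
      clm_ext fun x y => by simp [h]
    exact DFunLike.congr_fun this v
  rw [leg12_apply, hn, leg12_apply, hn, LinearIsometryEquiv.symm_apply_apply,
    LinearIsometryEquiv.symm_apply_apply, hv]

theorem tmap_tmap_leg13 (W : HTensor H₁ H₃ ≃ₗᵢ[ℂ] HTensor H₁ H₃)
    (W' : HTensor H₁ H₃' ≃ₗᵢ[ℂ] HTensor H₁ H₃') (T : H₂ →L[ℂ] H₂') (S : H₃ →L[ℂ] H₃')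
    (h : ∀ z, tmap (.id ℂ H₁) S (W z) = W' (tmap (.id ℂ H₁) S z)) (z) :
    tmap (.id ℂ H₁) (tmap T S) (leg13 W H₂ z) =
      leg13 W' H₂' (tmap (.id ℂ H₁) (tmap T S) z) := by
  have h1 : ∀ v, tmap (.id ℂ H₁) (tmap T S) (leg12 (flip H₂ H₁) H₃ v) =
      leg12 (flip H₂' H₁) H₃' (tmap T (tmap (.id ℂ H₁) S) v) := by
    intro v
    have : tmap (.id ℂ H₁) (tmap T S) ∘L toCLM (leg12 (flip H₂ H₁) H₃) =
      toCLM (leg12 (flip H₂' H₁) H₃') ∘L tmap T (tmap (.id ℂ H₁) S) :=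
      clm_ext₃ fun x y z => by simp
    exact DFunLike.congr_fun this v
  obtain ⟨v, rfl⟩ := (leg12 (flip H₂ H₁) H₃).surjective z
  have hv : tmap T (tmap (.id ℂ H₁) S) (leg23 H₂ W v) =
      leg23 H₂' W' (tmap T (tmap (.id ℂ H₁) S) v) := by
    have : tmap T (tmap (.id ℂ H₁) S) ∘L toCLM (leg23 H₂ W) =
      toCLM (leg23 H₂' W') ∘L tmap T (tmap (.id ℂ H₁) S) := clm_ext fun x y => by simp [h]
    exact DFunLike.congr_fun this v
  rw [leg13_apply, leg12_flip_flip, h1, h1, leg13_apply, leg12_flip_flip, hv]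

theorem leg12_trans (A : HTensor H₁ H₂ ≃ₗᵢ[ℂ] HTensor H₁' H₂')
    (B : HTensor H₁' H₂' ≃ₗᵢ[ℂ] HTensor H H') :
    leg12 (B ∘ᵤ A) H₃ = leg12 B H₃ ∘ᵤ leg12 A H₃ := by
  have h : utensor (B ∘ᵤ A) (.refl ℂ H₃) = utensor B (.refl ℂ H₃) ∘ᵤ utensor A (.refl ℂ H₃) :=
    utensor_trans A B (.refl ℂ H₃) (.refl ℂ H₃)
  ext z
  simp [leg12_apply, h]

@[simp] theorem leg23_refl : leg23 H (.refl ℂ H') = .refl ℂ _ :=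
  ext_tmul fun x y => by simp

@[simp] theorem leg12_refl : leg12 (.refl ℂ (HTensor H H')) H₁ = .refl ℂ _ :=
  ext_tmul₃ fun x y z => by simp [leg12_tmul]

@[simp] theorem leg13_refl : leg13 (.refl ℂ (HTensor H H')) H₁ = .refl ℂ _ := by
  ext z
  simp [leg13_apply]

/-- A tensor of the form `z ⊗ x` on the legs `13` and `2` of a threefold tensor product. -/
theorem leg13_tmap_tmulL (A : HTensor H₁ H₃ ≃ₗᵢ[ℂ] HTensor H₁' H₃') (x : H₂) (z) :
    leg13 A H₂ (tmap (.id ℂ H₁) (tmulL x) z) = tmap (.id ℂ H₁') (tmulL x) (A z) := by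
  have h : ∀ (G G' : Type u) [NormedAddCommGroup G] [InnerProductSpace ℂ G]
      [NormedAddCommGroup G'] [InnerProductSpace ℂ G'] (z : HTensor G G'),
      tmap (.id ℂ G) (tmulL x) z = leg12 (flip H₂ G) G' (tmul x z) := by
    intro G G' _ _ _ _ z
    have : tmap (.id ℂ G) (tmulL x) = toCLM (leg12 (flip H₂ G) G') ∘L tmulL x :=
      clm_ext fun a b => by simp
    exact DFunLike.congr_fun this z
  rw [h, h, leg13_apply, leg12_flip_flip, leg23_tmul]

theorem leg12_tmap_tmulL_flip (A : HTensor H₁ H₂ ≃ₗᵢ[ℂ] HTensor H₁' H₂') (x : H₃) (z) :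
    leg12 A H₃ (tmap (.id ℂ H₁) (tmulL.flip x) z) = tmap (.id ℂ H₁') (tmulL.flip x) (A z) := by
  have h : ∀ (G G' : Type u) [NormedAddCommGroup G] [InnerProductSpace ℂ G]
      [NormedAddCommGroup G'] [InnerProductSpace ℂ G'] (z : HTensor G G'),
      tmap (.id ℂ G) (tmulL.flip x) z = assoc G G' H₃ (tmul z x) := by
    intro G G' _ _ _ _ z
    have : tmap (.id ℂ G) (tmulL.flip x) = toCLM (assoc G G' H₃) ∘L tmulL.flip x :=
      clm_ext fun a b => by simp
    exact DFunLike.congr_fun this z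
  rw [h, h, leg12_apply, LinearIsometryEquiv.symm_apply_apply, utensor_tmul]
  rfl

/-- Every vector can be written with its H₂ component pulled to the front; on such vectors both
sides apply A to the remaining pair and put that component last. This makes the flip an arrow from
ι(W) × W' to W' × ι(W). -/
theorem leg23_flip_leg13 (A : HTensor H₁ H₃ ≃ₗᵢ[ℂ] HTensor H₁' H₃') :
    leg23 H₁' (flip H₂ H₃') ∘ᵤ leg13 A H₂ = leg12 A H₂ ∘ᵤ leg23 H₁ (flip H₂ H₃) := by
  have h : ∀ (G G' : Type u) [NormedAddCommGroup G] [InnerProductSpace ℂ G]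
      [NormedAddCommGroup G'] [InnerProductSpace ℂ G'] (x : H₂) (z : HTensor G G'),
      leg23 G (flip H₂ G') (leg12 (flip H₂ G) G' (tmul x z)) = assoc G G' H₂ (tmul z x) := by
    intro G G' _ _ _ _ x z
    have : leg23 G (flip H₂ G') ∘ᵤ leg12 (flip H₂ G) G' =
      assoc G G' H₂ ∘ᵤ flip H₂ (HTensor G G') := ext_tmul₃ fun a b c => by simp
    simpa using DFunLike.congr_fun this (tmul x z)
  have key : (leg23 H₁' (flip H₂ H₃') ∘ᵤ leg13 A H₂) ∘ᵤ leg12 (flip H₂ H₁) H₃ =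
      (leg12 A H₂ ∘ᵤ leg23 H₁ (flip H₂ H₃)) ∘ᵤ leg12 (flip H₂ H₁) H₃ :=
    ext_tmul fun x z => by
      simp only [LinearIsometryEquiv.trans_apply, leg13_apply, leg12_flip_flip, leg23_tmul, h]
      simp [leg12_apply]
  ext z
  obtain ⟨z, rfl⟩ := (leg12 (flip H₂ H₁) H₃).surjective z
  exact DFunLike.congr_fun key z

/-- This and the next two lemmas compare the two bracketings of the last three of four factors, for
operators on legs 12, 13 and 14. Together they show that the associator is an arrow. -/
theorem leg12_leg23_assoc (a : HTensor H₁ H₂ ≃ₗᵢ[ℂ] HTensor H₁' H₂') (z) :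
    leg12 a (HTensor H H') (leg23 H₁ (assoc H₂ H H') z) =
      leg23 H₁' (assoc H₂' H H') (leg12 (leg12 a H) H' z) := by
  obtain ⟨z, rfl⟩ := (assoc H₁ (HTensor H₂ H) H').surjective z
  rw [assoc_leg12, leg12_apply (leg12 a H), LinearIsometryEquiv.symm_apply_apply]

theorem leg13_leg12_leg23_assoc (b : HTensor H₁ H ≃ₗᵢ[ℂ] HTensor H₁ H) (z) :
    leg13 (leg12 b H') H₂ (leg23 H₁ (assoc H₂ H H') z) =
      leg23 H₁ (assoc H₂ H H') (leg12 (leg13 b H₂) H' z) := by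
  obtain ⟨z, rfl⟩ := (assoc H₁ (HTensor H₂ H) H').surjective z
  have h13 : ∀ t, utensor (leg13 b H₂) (.refl ℂ H') t =
      utensor (leg12 (flip H₂ H₁) H) (.refl ℂ H') (utensor (leg23 H₂ b) (.refl ℂ H')
        (utensor (leg12 (flip H₁ H₂) H) (.refl ℂ H') t)) := by
    intro t
    have h : utensor (leg13 b H₂) (.refl ℂ H') = ((utensor (leg12 (flip H₁ H₂) H) (.refl ℂ H')).trans
      (utensor (leg23 H₂ b) (.refl ℂ H'))).trans (utensor (leg12 (flip H₂ H₁) H) (.refl ℂ H')) :=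
      ext_tmul fun x y => by simp [leg13_apply]
    exact DFunLike.congr_fun h t
  rw [leg12_apply (leg13 b H₂), LinearIsometryEquiv.symm_apply_apply, h13, leg13_apply,
    assoc_leg12, assoc_leg23, assoc_leg12]

theorem leg13_leg13_leg23_assoc (c : HTensor H₁ H' ≃ₗᵢ[ℂ] HTensor H₁ H') (z) :
    leg13 (leg13 c H) H₂ (leg23 H₁ (assoc H₂ H H') z) =
      leg23 H₁ (assoc H₂ H H') (leg13 c (HTensor H₂ H) z) := by
  have s1 : ∀ t, leg23 H₂ (leg12 (flip H₁ H) H') (leg12 (flip H₁ H₂) (HTensor H H')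
      (leg23 H₁ (assoc H₂ H H') t)) =
      assoc H₂ H (HTensor H₁ H') (leg12 (flip H₁ (HTensor H₂ H)) H' t) := by
    intro t
    have h : leg23 H₂ (leg12 (flip H₁ H) H') ∘ᵤ leg12 (flip H₁ H₂) (HTensor H H') ∘ᵤ
        leg23 H₁ (assoc H₂ H H') =
        assoc H₂ H (HTensor H₁ H') ∘ᵤ leg12 (flip H₁ (HTensor H₂ H)) H' :=
      ext_tmul₄ fun x y z w => by simp
    exact DFunLike.congr_fun h t
  have s2 : ∀ t, leg12 (flip H₂ H₁) (HTensor H H') (leg23 H₂ (leg12 (flip H H₁) H')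
      (assoc H₂ H (HTensor H₁ H') t)) =
      leg23 H₁ (assoc H₂ H H') (leg12 (flip (HTensor H₂ H) H₁) H' t) := by
    intro t
    have h : leg12 (flip H₂ H₁) (HTensor H H') ∘ᵤ leg23 H₂ (leg12 (flip H H₁) H') ∘ᵤ
        assoc H₂ H (HTensor H₁ H') =
        leg23 H₁ (assoc H₂ H H') ∘ᵤ leg12 (flip (HTensor H₂ H) H₁) H' :=
      ext_tmul₄' fun x y z w => by simp
    exact DFunLike.congr_fun h t
  have s3 : ∀ t, leg23 H₂ (leg23 H c) (assoc H₂ H (HTensor H₁ H') t) =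
      assoc H₂ H (HTensor H₁ H') (leg23 (HTensor H₂ H) c t) := by
    intro t
    have h : leg23 H₂ (leg23 H c) ∘ᵤ assoc H₂ H (HTensor H₁ H') =
      assoc H₂ H (HTensor H₁ H') ∘ᵤ leg23 (HTensor H₂ H) c :=
      ext_tmul₃' fun x y z => by simp
    exact DFunLike.congr_fun h t
  have s4 : leg13 c H = leg12 (flip H H₁) H' ∘ᵤ leg23 H c ∘ᵤ leg12 (flip H₁ H) H' := rfl
  rw [leg13_apply, s4, leg23_trans, leg23_trans, leg13_apply c, ← s2, ← s3, ← s1]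
  rfl

/-! ### Adjoints of tensor products and of intertwiners. -/

section Adjoint

variable [CompleteSpace H] [CompleteSpace H₁] [CompleteSpace H'] [CompleteSpace H₁']

theorem adjoint_tmap (S : H →L[ℂ] H₁) (T : H' →L[ℂ] H₁') :
    (tmap S T).adjoint = tmap S.adjoint T.adjoint := by
  refine clm_ext fun x y => ext_inner_right ℂ fun w => ?_
  have : innerSL ℂ ((tmap S T).adjoint (tmul x y)) =
      innerSL ℂ (tmap S.adjoint T.adjoint (tmul x y)) := clm_ext fun a b => by
    simp [ContinuousLinearMap.adjoint_inner_left, inner_tmul]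
  exact DFunLike.congr_fun this w

/-- Since A and B are unitary, it is enough to test against vectors A w and move S across the inner
product. -/
theorem adjoint_intertwines {S : H →L[ℂ] H'} {A : H ≃ₗᵢ[ℂ] H} {B : H' ≃ₗᵢ[ℂ] H'}
    (h : ∀ z, S (A z) = B (S z)) (z : H') : S.adjoint (B z) = A (S.adjoint z) := by
  refine ext_inner_right ℂ fun w => ?_
  obtain ⟨w, rfl⟩ := A.surjective w
  rw [A.inner_map_map, ContinuousLinearMap.adjoint_inner_left,
    ContinuousLinearMap.adjoint_inner_left, h, B.inner_map_map]

end Adjoint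

theorem adjoint_tmulL_tmul [CompleteSpace H'] (x a : H) (b : H') :
    (tmulL (H' := H') x).adjoint (tmul a b) = inner ℂ x a • b := by
  refine ext_inner_right ℂ fun w => ?_
  rw [ContinuousLinearMap.adjoint_inner_left, tmulL_apply, inner_tmul, inner_smul_left,
    inner_conj_symm]

theorem adjoint_tmulL_flip_tmul [CompleteSpace H] (y b : H') (a : H) :
    ((tmulL (H := H)).flip y).adjoint (tmul a b) = inner ℂ y b • a := by
  refine ext_inner_right ℂ fun w => ?_
  rw [ContinuousLinearMap.adjoint_inner_left, ContinuousLinearMap.flip_apply, tmulL_apply,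
    inner_tmul, inner_smul_left, inner_conj_symm, mul_comm]

end Operators

/-! ### Intertwiners -/

section Intertwiners

variable {K : Type u} [NormedAddCommGroup K] [InnerProductSpace ℂ K]
  {H H' H'' H''' : Type u}
  [NormedAddCommGroup H] [InnerProductSpace ℂ H]
  [NormedAddCommGroup H'] [InnerProductSpace ℂ H']
  [NormedAddCommGroup H''] [InnerProductSpace ℂ H'']
  [NormedAddCommGroup H'''] [InnerProductSpace ℂ H''']
  {W : HTensor K H ≃ₗᵢ[ℂ] HTensor K H} {W' : HTensor K H' ≃ₗᵢ[ℂ] HTensor K H'}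
  {W'' : HTensor K H'' ≃ₗᵢ[ℂ] HTensor K H''} {W''' : HTensor K H''' ≃ₗᵢ[ℂ] HTensor K H'''}

theorem IsIntertwiner.id (W : HTensor K H ≃ₗᵢ[ℂ] HTensor K H) :
    IsIntertwiner W W (.id ℂ H) := fun z => by simp

theorem IsIntertwiner.comp {S : H' →L[ℂ] H''} {T : H →L[ℂ] H'} (hS : IsIntertwiner W' W'' S)
    (hT : IsIntertwiner W W' T) : IsIntertwiner W W'' (S ∘L T) := by
  intro z
  have h : tmap (.id ℂ K) (S ∘L T) = tmap (.id ℂ K) S ∘L tmap (.id ℂ K) T :=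
    tmap_comp (.id ℂ K) T (.id ℂ K) S
  rw [h, ContinuousLinearMap.comp_apply, hT, hS, ContinuousLinearMap.comp_apply]

theorem isIntertwiner_toCLM_iff {A : H ≃ₗᵢ[ℂ] H'} :
    IsIntertwiner W W' (toCLM A) ↔ leg23 K A ∘ᵤ W = W' ∘ᵤ leg23 K A := by
  simp only [IsIntertwiner, tmap_id_toCLM]
  exact ⟨fun h => LinearIsometryEquiv.ext h, fun h z => DFunLike.congr_fun h z⟩

theorem IsIntertwiner.symm {A : H ≃ₗᵢ[ℂ] H'} (hA : IsIntertwiner W W' (toCLM A)) :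
    IsIntertwiner W' W (toCLM A.symm) := by
  intro z
  obtain ⟨z, rfl⟩ := (leg23 K A).surjective z
  have h : ∀ z, leg23 K A.symm (leg23 K A z) = z := fun z => by simp [leg23_leg23_apply]
  have hz := hA z
  rw [tmap_id_toCLM, tmap_id_toCLM] at hz
  rw [tmap_id_toCLM, tmap_id_toCLM, ← hz, h, h]

theorem IsIntertwiner.trans {A : H ≃ₗᵢ[ℂ] H'} {B : H' ≃ₗᵢ[ℂ] H''}
    (hA : IsIntertwiner W W' (toCLM A)) (hB : IsIntertwiner W' W'' (toCLM B)) :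
    IsIntertwiner W W'' (toCLM (B ∘ᵤ A)) := by
  rw [isIntertwiner_toCLM_iff] at *
  ext z
  have h := DFunLike.congr_fun hA z
  have h' := DFunLike.congr_fun hB (leg23 K A z)
  simp only [LinearIsometryEquiv.trans_apply, leg23_trans] at h h' ⊢
  rw [h, h']

theorem IsIntertwiner.adjoint [CompleteSpace K] [CompleteSpace H] [CompleteSpace H']
    {T : H →L[ℂ] H'} (hT : IsIntertwiner W W' T) : IsIntertwiner W' W T.adjoint := by
  have h : tmap (.id ℂ K) T.adjoint = (tmap (.id ℂ K) T).adjoint := by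
    rw [adjoint_tmap, ContinuousLinearMap.adjoint_id]
  intro z
  rw [h]
  exact adjoint_intertwines hT z

theorem IsIntertwiner.tensor {T : H →L[ℂ] H'} {S : H'' →L[ℂ] H'''} (hT : IsIntertwiner W W' T)
    (hS : IsIntertwiner W'' W''' S) :
    IsIntertwiner (corepTensor W W'') (corepTensor W' W''') (tmap T S) := by
  intro z
  simp only [corepTensor, LinearIsometryEquiv.trans_apply]
  rw [tmap_tmap_leg12 W W' T S hT, tmap_tmap_leg13 W'' W''' T S hS]

theorem isIntertwiner_assoc :
    IsIntertwiner (corepTensor (corepTensor W W') W'') (corepTensor W (corepTensor W' W''))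
      (toCLM (assoc H H' H'')) := by
  rw [isIntertwiner_toCLM_iff]
  ext z
  simp only [corepTensor, LinearIsometryEquiv.trans_apply, leg12_trans, leg13_trans,
    leg13_leg13_leg23_assoc, leg13_leg12_leg23_assoc, leg12_leg23_assoc]

/-- The unitary of a trivial corepresentation times W' is just W'₁₃, which ignores the middle
factor. These arrows and their adjoints are what slices are made of. -/
theorem isIntertwiner_tmulL (x : H) :
    IsIntertwiner W' (corepTensor (.refl ℂ (HTensor K H)) W') (tmulL x) := by
  intro z
  simp only [corepTensor, LinearIsometryEquiv.trans_apply, leg12_refl,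
    LinearIsometryEquiv.coe_refl, id_eq, leg13_tmap_tmulL]

theorem isIntertwiner_tmulL_flip (y : H') :
    IsIntertwiner W (corepTensor W (.refl ℂ (HTensor K H'))) (tmulL.flip y) := by
  intro z
  simp only [corepTensor, LinearIsometryEquiv.trans_apply, leg13_refl,
    LinearIsometryEquiv.coe_refl, id_eq, leg12_tmap_tmulL_flip]

theorem isIntertwiner_flip :
    IsIntertwiner (corepTensor (.refl ℂ (HTensor K H)) W')
      (corepTensor W' (.refl ℂ (HTensor K H))) (toCLM (flip H H')) := by
  rw [isIntertwiner_toCLM_iff]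
  have := leg23_flip_leg13 (H₂ := H) W'
  ext z
  simpa [corepTensor] using DFunLike.congr_fun this z

/-- V × ι(W) is V₁₂ and V × W is V₁₂ W₁₃, so this is the corepresentation equation read from right
to left. It is the arrow ξ_W⁻¹. -/
theorem IsCorep.isIntertwiner {V : HTensor K K ≃ₗᵢ[ℂ] HTensor K K} (h : IsCorep V W) :
    IsIntertwiner (corepTensor V (.refl ℂ (HTensor K H))) (corepTensor V W) (toCLM W) := by
  rw [isIntertwiner_toCLM_iff]
  ext z
  simpa [corepTensor] using (DFunLike.congr_fun h z).symm

/-- Composite of arrows W × V → ι(W) × V → V × ι(W) → V × W. -/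
theorem IsCorep.isIntertwiner_braiding {V : HTensor K K ≃ₗᵢ[ℂ] HTensor K K} (h : IsCorep V W)
    {A : HTensor H K ≃ₗᵢ[ℂ] HTensor H K}
    (hA : IsIntertwiner (corepTensor W V) (corepTensor (.refl ℂ (HTensor K H)) V) (toCLM A)) :
    IsIntertwiner (corepTensor W V) (corepTensor V W) (toCLM (W ∘ᵤ flip H K ∘ᵤ A)) :=
  (hA.trans isIntertwiner_flip).trans h.isIntertwiner

theorem isIntertwiner_utensor_refl (U : H ≃ₗᵢ[ℂ] H) :
    IsIntertwiner (corepTensor (.refl ℂ (HTensor K H)) W')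
      (corepTensor (.refl ℂ (HTensor K H)) W') (toCLM (utensor U (.refl ℂ H'))) := by
  have h : toCLM (utensor U (.refl ℂ H')) = tmap (toCLM U) (.id ℂ H') :=
    clm_ext fun x y => by simp
  rw [h]
  exact IsIntertwiner.tensor (fun _ => rfl) (IsIntertwiner.id _)

theorem isIntertwiner_refl (T : H →L[ℂ] H') :
    IsIntertwiner (.refl ℂ (HTensor K H)) (.refl ℂ (HTensor K H')) T := fun _ => rfl

end Intertwiners

/-! ### Extending a unitary on `K` to all objects of `C(V)_V` -/

section WordUnitary

variable {K : Type u} [NormedAddCommGroup K] [InnerProductSpace ℂ K] [CompleteSpace K]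

/-- The unitary on the space of each object determined multiplicatively by a unitary on `K`; it is
the identity on trivial corepresentations. -/
def wordUnitary (V : MultUnitary K) (U : K ≃ₗᵢ[ℂ] K) :
    ∀ w : Word, w.space V ≃ₗᵢ[ℂ] w.space V
  | .one => .refl ℂ _
  | .reg => U
  | .triv _ => .refl ℂ _
  | .tensor w w' => utensor (wordUnitary V U w) (wordUnitary V U w')

variable {V : MultUnitary K} {U : K ≃ₗᵢ[ℂ] K}

theorem wordUnitary_power (r : ℕ) :
    wordUnitary V U (MultUnitary.power r) = V.upower U r := by
  induction r with
  | zero => rfl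
  | succ r ih => exact congrArg (fun A => utensor A U) ih

variable (V U) in
/-- An arrow of `C(V)_V` commuting with the unitaries `wordUnitary V U`. -/
def IsCompatible (w w' : Word) (T : w.space V →L[ℂ] w'.space V) : Prop :=
  Word.IsHom V w w' T ∧ ∀ z, T (wordUnitary V U w z) = wordUnitary V U w' (T z)

namespace IsCompatible

variable {w w' w'' w₁ w₂ w₃ : Word}

theorem id (w : Word) : IsCompatible V U w w (.id ℂ (w.space V)) := ⟨IsIntertwiner.id _, fun _ => rfl⟩

theorem comp {S : w'.space V →L[ℂ] w''.space V} {T : w.space V →L[ℂ] w'.space V}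
    (hS : IsCompatible V U w' w'' S) (hT : IsCompatible V U w w' T) :
    IsCompatible V U w w'' (S ∘L T) :=
  ⟨IsIntertwiner.comp hS.1 hT.1, fun z => by
    rw [ContinuousLinearMap.comp_apply, hT.2, hS.2, ContinuousLinearMap.comp_apply]⟩

theorem adjoint {T : w.space V →L[ℂ] w'.space V} (hT : IsCompatible V U w w' T) :
    IsCompatible V U w' w T.adjoint :=
  ⟨IsIntertwiner.adjoint hT.1, adjoint_intertwines hT.2⟩

theorem tensor {T : w.space V →L[ℂ] w'.space V} {S : w₁.space V →L[ℂ] w₂.space V}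
    (hT : IsCompatible V U w w' T) (hS : IsCompatible V U w₁ w₂ S) :
    IsCompatible V U (w.tensor w₁) (w'.tensor w₂) (tmap T S) := by
  refine ⟨IsIntertwiner.tensor hT.1 hS.1, fun z => ?_⟩
  have : tmap T S ∘L toCLM (utensor (wordUnitary V U w) (wordUnitary V U w₁)) =
      toCLM (utensor (wordUnitary V U w') (wordUnitary V U w₂)) ∘L tmap T S :=
    clm_ext fun x y => by simp [hT.2, hS.2]
  exact DFunLike.congr_fun this z

theorem assoc (w w' w'' : Word) :
    IsCompatible V U ((w.tensor w').tensor w'') (w.tensor (w'.tensor w''))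
      (toCLM (MulUnitary.assoc (w.space V) (w'.space V) (w''.space V))) := by
  refine ⟨isIntertwiner_assoc, fun z => ?_⟩
  have : MulUnitary.assoc (w.space V) (w'.space V) (w''.space V) ∘ᵤ
      utensor (utensor (wordUnitary V U w) (wordUnitary V U w')) (wordUnitary V U w'') =
      utensor (wordUnitary V U w) (utensor (wordUnitary V U w') (wordUnitary V U w'')) ∘ᵤ
      MulUnitary.assoc (w.space V) (w'.space V) (w''.space V) :=
    ext_tmul₃' fun x y z => by simp
  exact DFunLike.congr_fun this z

end IsCompatible

/-- The unit vector spanning the tensor unit. -/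
def unitVec : EuclideanSpace ℂ PUnit.{u + 1} := EuclideanSpace.single PUnit.unit 1

theorem eq_smul_unitVec (x : EuclideanSpace ℂ PUnit.{u + 1}) : x = x PUnit.unit • unitVec := by
  ext i
  simp [unitVec]

theorem norm_unitVec : ‖unitVec.{u}‖ = 1 := by simp [unitVec]

theorem inner_unitVec : inner ℂ unitVec.{u} unitVec.{u} = (1 : ℂ) := by
  rw [inner_self_eq_norm_sq_to_K, norm_unitVec]; simp

theorem isCompatible_tmulL_unitVec (w : Word) :
    IsCompatible V U w (Word.one.tensor w) (tmulL unitVec) :=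
  ⟨isIntertwiner_tmulL _, fun z => (utensor_tmul (H := EuclideanSpace ℂ PUnit.{u + 1}) (.refl ℂ _)
    (wordUnitary V U w) unitVec z).symm⟩

theorem isCompatible_tmulL_flip_unitVec (w : Word) :
    IsCompatible V U w (w.tensor .one) (tmulL.flip unitVec) :=
  ⟨isIntertwiner_tmulL_flip _, fun z => (utensor_tmul (H' := EuclideanSpace ℂ PUnit.{u + 1})
    (wordUnitary V U w) (.refl ℂ _) z unitVec).symm⟩

/-! ### Reduction of arbitrary objects to tensor powers of V. -/

theorem mem_of_denseRange {E F : Type*} [NormedAddCommGroup E] [NormedSpace ℂ E]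
    [NormedAddCommGroup F] [NormedSpace ℂ F] {T : E →L[ℂ] F} (hT : DenseRange T)
    {C : Submodule ℂ F} (hC : IsClosed (C : Set F)) (h : ∀ x, T x ∈ C) (y : F) : y ∈ C :=
  hT.induction_on (p := fun y => y ∈ C) y hC h

theorem denseRange_tmap {H H₁ H' H₁' : Type u}
    [NormedAddCommGroup H] [InnerProductSpace ℂ H] [NormedAddCommGroup H₁] [InnerProductSpace ℂ H₁]
    [NormedAddCommGroup H'] [InnerProductSpace ℂ H']
    [NormedAddCommGroup H₁'] [InnerProductSpace ℂ H₁'] {S : H →L[ℂ] H₁} {T : H' →L[ℂ] H₁'}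
    (hS : DenseRange S) (hT : DenseRange T) : DenseRange (tmap S T) := by
  intro w
  set C := (LinearMap.range (tmap S T).toLinearMap).topologicalClosure
  have hC : IsClosed (C : Set (HTensor H₁ H₁')) := Submodule.isClosed_topologicalClosure _
  refine mem_of_tmul_mem C hC (fun x y => ?_) w
  refine hS.induction_on (p := fun x => tmul x y ∈ C) x
    (hC.preimage (tmulL.flip y).continuous) fun a => ?_
  refine hT.induction_on (p := fun y => tmul (S a) y ∈ C) y
    (hC.preimage (tmulL (S a)).continuous) fun b => ?_
  exact Submodule.le_topologicalClosure _ ⟨tmul a b, tmap_tmul S T a b⟩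

-- The arrow is assembled from associators and insertions of the unit vector. Dense range is all
-- that the later continuity argument needs, so no inverse is constructed.
open MultUnitary in
variable (V U) in
theorem exists_isCompatible_power_add (r s : ℕ) :
    ∃ m : (power (r + s)).space V →L[ℂ] ((power r).tensor (power s)).space V,
      IsCompatible V U (power (r + s)) ((power r).tensor (power s)) m ∧ DenseRange m := by
  induction s with
  | zero =>
    refine ⟨tmulL.flip unitVec, isCompatible_tmulL_flip_unitVec (power r), fun w => ?_⟩
    refine mem_of_tmul_mem (LinearMap.range ((tmulL (H := (power r).space V)).flip
      unitVec).toLinearMap).topologicalClosure (Submodule.isClosed_topologicalClosure _)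
      (fun x y => Submodule.le_topologicalClosure _ ⟨y PUnit.unit • x, ?_⟩) w
    change tmul (y PUnit.unit • x) unitVec = tmul x y
    rw [smul_tmul, ← tmul_smul, ← eq_smul_unitVec]
  | succ s ih =>
    obtain ⟨m, hm, hd⟩ := ih
    refine ⟨toCLM (assoc ((power r).space V) ((power s).space V) K) ∘L tmap m (.id ℂ K),
      (IsCompatible.assoc (power r) (power s) .reg).comp (hm.tensor (IsCompatible.id .reg)), ?_⟩
    exact ((LinearIsometryEquiv.surjective _).denseRange).comp
      (denseRange_tmap hd Function.surjective_id.denseRange)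
      (ContinuousLinearMap.continuous _)

open MultUnitary in
/-- The compatible arrows from tensor powers of `V` into an object have jointly dense range. -/
theorem mem_of_power_mem (w : Word) (C : Submodule ℂ (w.space V))
    (hC : IsClosed (C : Set (w.space V)))
    (h : ∀ (r : ℕ) (j : (power r).space V →L[ℂ] w.space V),
      IsCompatible V U (power r) w j → ∀ x, j x ∈ C) (z : w.space V) : z ∈ C := by
  induction w with
  | one => exact h 0 (.id ℂ _) (IsCompatible.id .one) z
  | reg =>
    -- V^{× 1} is the unit times V, not V itself, so the arrow back to V contracts the unit factor.
    have := h 1 (tmulL unitVec).adjoint (isCompatible_tmulL_unitVec .reg).adjoint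
      (tmul unitVec z)
    have e : (tmulL (H' := K) unitVec).adjoint (tmul unitVec z) = z := by
      rw [adjoint_tmulL_tmul, inner_unitVec, one_smul]
    exact e ▸ this
  | triv w ih =>
    -- Every vector of a trivial corepresentation is the image of the unit vector under an arrow
    -- from the unit, so no induction is needed here.
    have := h 0 ((EuclideanSpace.proj PUnit.unit : _ →L[ℂ] ℂ).smulRight z)
      ⟨isIntertwiner_refl _, fun _ => rfl⟩ unitVec
    have e : (EuclideanSpace.proj PUnit.unit : EuclideanSpace ℂ PUnit.{u + 1} →L[ℂ] ℂ).smulRight z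
        unitVec = z := by simp [unitVec]
    exact e ▸ this
  | tensor w w' ih ih' =>
    refine mem_of_tmul_mem C hC (fun x y => ?_) z
    -- One tensor factor is varied at a time: for fixed y the admissible x form a closed subspace,
    -- and then conversely.
    refine ih (C.comap (tmulL.flip y).toLinearMap) (hC.preimage (tmulL.flip y).continuous)
      (fun r j hj a => ?_) x
    refine ih' (C.comap (tmulL (j a)).toLinearMap) (hC.preimage (tmulL (j a)).continuous)
      (fun s k hk b => ?_) y
    obtain ⟨m, hm, hd⟩ := exists_isCompatible_power_add V U r s
    have := mem_of_denseRange hd (C := C.comap (tmap j k).toLinearMap)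
      (hC.preimage (tmap j k).continuous)
      (fun v => h (r + s) (tmap j k ∘L m) ((hj.tensor hk).comp hm) v) (tmul a b)
    change tmul (j a) (k b) ∈ C
    exact tmap_tmul j k a b ▸ this

open MultUnitary in
/-- For `U ∈ G_V` the unitaries `wordUnitary V U` commute with all arrows of `C(V)_V`. -/
theorem wordUnitary_natural (hU : U ∈ V.G) {w w' : Word} {T : w.space V →L[ℂ] w'.space V}
    (hT : Word.IsHom V w w' T) (z) : T (wordUnitary V U w z) = wordUnitary V U w' (T z) := by
  -- Both sides are continuous in z, so agreement on the ranges of compatible arrows from tensor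
  -- powers suffices.
  have reduce : ∀ (w w' : Word) (T : w.space V →L[ℂ] w'.space V),
      (∀ (r : ℕ) (j : (power r).space V →L[ℂ] w.space V), IsCompatible V U (power r) w j →
        ∀ x, T (j (wordUnitary V U _ x)) = wordUnitary V U w' (T (j x))) →
      ∀ z, T (wordUnitary V U w z) = wordUnitary V U w' (T z) := by
    intro w w' T h z
    refine mem_of_power_mem (U := U) w (LinearMap.eqLocus
      (T ∘L toCLM (wordUnitary V U w)).toLinearMap
      (toCLM (wordUnitary V U w') ∘L T).toLinearMap)
      (isClosed_eq (ContinuousLinearMap.continuous _) (ContinuousLinearMap.continuous _))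
      (fun r j hj x => ?_) z
    change T (wordUnitary V U w (j x)) = wordUnitary V U w' (T (j x))
    rw [← hj.2, h r j hj]
  -- With a tensor power as target, precomposing with j gives an arrow between tensor powers, where
  -- the definition of G_V applies.
  have toPower : ∀ (w : Word) (s : ℕ) (T : w.space V →L[ℂ] (power s).space V),
      Word.IsHom V w (power s) T → IsCompatible V U w (power s) T := by
    refine fun w s T hT => ⟨hT, reduce w _ T fun r j hj x => ?_⟩
    rw [wordUnitary_power, wordUnitary_power]
    exact hU r s (T ∘L j) (IsIntertwiner.comp hT hj.1) x
  -- Taking adjoints exchanges source and target, giving the case of arrows out of a power; a second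
  -- use of `reduce` then treats general arrows.
  have fromPower : ∀ (w : Word) (s : ℕ) (T : (power s).space V →L[ℂ] w.space V),
      Word.IsHom V (power s) w T → IsCompatible V U (power s) w T := by
    intro w s T hT
    have := (toPower w s T.adjoint (IsIntertwiner.adjoint hT)).adjoint
    rwa [ContinuousLinearMap.adjoint_adjoint] at this
  exact reduce w w' T (fun r j hj x => (fromPower w' r (T ∘L j)
    (IsIntertwiner.comp hT hj.1)).2 x) z

end WordUnitary

/-! ### Cancellation and testing on elementary tensors. -/

section ElementaryTensors

variable {H H' : Type u} [NormedAddCommGroup H] [InnerProductSpace ℂ H]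
  [NormedAddCommGroup H'] [InnerProductSpace ℂ H']

theorem subsingleton_hTensor [Subsingleton H'] : Subsingleton (HTensor H H') := by
  refine subsingleton_of_forall_eq 0 fun z => ?_
  refine mem_of_tmul_mem ⊥ isClosed_singleton (fun x y => ?_) z
  rw [Submodule.mem_bot, ← norm_eq_zero, norm_tmul, Subsingleton.elim y 0, norm_zero, mul_zero]

theorem tmul_left_injective {y : H'} (hy : y ≠ 0) {x x' : H} (h : tmul x y = tmul x' y) :
    x = x' := by
  have : (tmulL.flip y) (x - x') = 0 := by
    rw [map_sub]
    exact sub_eq_zero.2 h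
  have hn : ‖tmul (x - x') y‖ = 0 := norm_eq_zero.2 this
  rw [norm_tmul, mul_eq_zero, norm_eq_zero, norm_eq_zero] at hn
  exact sub_eq_zero.1 (hn.resolve_right hy)

theorem utensor_refl_injective [Nontrivial H'] {A B : H ≃ₗᵢ[ℂ] H}
    (h : utensor A (.refl ℂ H') = utensor B (.refl ℂ H')) : A = B := by
  obtain ⟨y, hy⟩ := exists_ne (0 : H')
  ext x
  have := DFunLike.congr_fun h (tmul x y)
  simp only [utensor_tmul, LinearIsometryEquiv.coe_refl, _root_.id] at this
  exact tmul_left_injective hy this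

theorem eq_of_inner_tmul {v w : HTensor H H'}
    (h : ∀ x y, inner ℂ (tmul x y) v = inner ℂ (tmul x y) w) : v = w := by
  have : innerSL ℂ (v - w) = 0 := clm_ext fun x y => by
    have := congrArg (starRingEnd ℂ) (h x y)
    simp only [inner_conj_symm] at this
    simp [this]
  rw [← sub_eq_zero, ← inner_self_eq_zero (𝕜 := ℂ)]
  exact DFunLike.congr_fun this (v - w)

end ElementaryTensors

/-! ### Slices of operators on H ⊗ K. -/

section Slices

variable {H K : Type u} [NormedAddCommGroup H] [InnerProductSpace ℂ H]
  [NormedAddCommGroup K] [InnerProductSpace ℂ K] [CompleteSpace K]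

/-- The slice `(⟨x'| × 1) X (|x⟩ × 1)` of an operator on `H ⊗ K`. -/
def slice (X : HTensor H K →L[ℂ] HTensor H K) (x' x : H) : K →L[ℂ] K :=
  (tmulL x').adjoint ∘L X ∘L tmulL x

theorem inner_slice (X : HTensor H K →L[ℂ] HTensor H K) (x' x : H) (y' y : K) :
    inner ℂ y' (slice X x' x y) = inner ℂ (tmul x' y') (X (tmul x y)) := by
  simp [slice, ContinuousLinearMap.adjoint_inner_right]

/-- A unitary on `H ⊗ K` all of whose slices are scalar is of the form `U × 1`. -/
theorem exists_eq_utensor_of_slices [CompleteSpace H] [Nontrivial K]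
    (X : HTensor H K ≃ₗᵢ[ℂ] HTensor H K)
    (h : ∀ x' x, ∃ c : ℂ, slice (toCLM X) x' x = c • .id ℂ K) :
    ∃ U : H ≃ₗᵢ[ℂ] H, X = utensor U (.refl ℂ K) := by
  obtain ⟨k, hk⟩ := exists_norm_eq K zero_le_one
  have hk0 : k ≠ 0 := by
    rintro rfl
    simp at hk
  -- The candidate for U is the slice in the other leg at a unit vector k; scalar slices make the
  -- choice of k irrelevant.
  let A : H →L[ℂ] H := ((tmulL (H := H)).flip k).adjoint ∘L toCLM X ∘L tmulL.flip k
  have hA : ∀ x y, X (tmul x y) = tmul (A x) y := by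
    intro x y
    refine eq_of_inner_tmul fun x' y' => ?_
    obtain ⟨c, hc⟩ := h x' x
    have e : ∀ a b, inner ℂ (tmul x' a) (X (tmul x b)) = c * inner ℂ a b := by
      intro a b
      rw [← toCLM_apply, ← inner_slice, hc]
      simp
    have eA : inner ℂ x' (A x) = c := by
      simp only [A, ContinuousLinearMap.comp_apply, ContinuousLinearMap.adjoint_inner_right,
        ContinuousLinearMap.flip_apply, tmulL_apply, toCLM_apply, e]
      simp [inner_self_eq_norm_sq_to_K, hk]
    rw [e, inner_tmul, eA]
  have hnorm : ∀ x, ‖A x‖ = ‖x‖ := by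
    intro x
    have := congrArg norm (hA x k)
    rwa [X.norm_map, norm_tmul, norm_tmul, hk, mul_one, mul_one, eq_comm] at this
  let Ai : H →ₗᵢ[ℂ] H := ⟨A.toLinearMap, hnorm⟩
  -- Contracting the second leg with k commutes with X = A × 1, so contracting a preimage of x ⊗ k
  -- yields a preimage of x under A.
  have hsurj : Function.Surjective Ai := by
    intro x
    have hz : ∀ z, X z = tmap A (.id ℂ K) z := by
      intro z
      have : toCLM X = tmap A (.id ℂ K) := clm_ext fun x y => by simp [hA]
      exact DFunLike.congr_fun this z
    have hs : ∀ z, ((tmulL (H := H)).flip k).adjoint (tmap A (.id ℂ K) z) =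
        A (((tmulL (H := H)).flip k).adjoint z) := by
      intro z
      have : ((tmulL (H := H)).flip k).adjoint ∘L tmap A (.id ℂ K) =
        A ∘L ((tmulL (H := H)).flip k).adjoint :=
        clm_ext fun x y => by simp [adjoint_tmulL_flip_tmul]
      exact DFunLike.congr_fun this z
    obtain ⟨z, hzx⟩ := X.surjective (tmul x k)
    refine ⟨((tmulL (H := H)).flip k).adjoint z, ?_⟩
    change A _ = x
    rw [← hs, ← hz, hzx, adjoint_tmulL_flip_tmul, inner_self_eq_norm_sq_to_K, hk]
    simp
  exact ⟨LinearIsometryEquiv.ofSurjective Ai hsurj, ext_tmul fun x y => by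
    rw [utensor_tmul, hA]; rfl⟩

/-- Slicing the first leg of X₁₂ leaves the third leg alone. This passes from an identity for X₁₂ to
one for the slices of X. -/
theorem tmap_slice (X : HTensor H K ≃ₗᵢ[ℂ] HTensor H K) (x' x : H) (z : HTensor K K) :
    tmap (slice (toCLM X) x' x) (.id ℂ K) z =
      (tmulL x').adjoint (leg12 X K (tmul x z)) := by
  have h1 : ∀ (v : HTensor H K) (k : K), (tmulL (H' := HTensor K K) x').adjoint
      (assoc H K K (tmul v k)) = tmul ((tmulL (H' := K) x').adjoint v) k := by
    intro v k
    have : (tmulL (H' := HTensor K K) x').adjoint ∘L toCLM (assoc H K K) ∘L tmulL.flip k =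
      tmulL.flip k ∘L (tmulL (H' := K) x').adjoint :=
      clm_ext fun a b => by simp [adjoint_tmulL_tmul]
    exact DFunLike.congr_fun this v
  have : tmap (slice (toCLM X) x' x) (.id ℂ K) =
      (tmulL x').adjoint ∘L toCLM (leg12 X K) ∘L tmulL x :=
    clm_ext fun a b => by simp [leg12_tmul, h1, slice]
  exact DFunLike.congr_fun this z

theorem isIntertwiner_slice {V : HTensor K K ≃ₗᵢ[ℂ] HTensor K K}
    {X : HTensor H K →L[ℂ] HTensor H K}
    (hX : IsIntertwiner (corepTensor (.refl ℂ (HTensor K H)) V)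
      (corepTensor (.refl ℂ (HTensor K H)) V) X) (x' x : H) :
    IsIntertwiner V V (slice X x' x) :=
  (isIntertwiner_tmulL x').adjoint.comp (hX.comp (isIntertwiner_tmulL x))

/-- Conjugating by the flip, T ∈ (V^d, V^d) means that T × 1 commutes with V⁻¹; this is the
hypothesis sliced in its first leg, which V⁻¹ on legs 2 and 3 does not touch. -/
theorem isIntertwiner_dual_slice {V : MultUnitary K} {X : HTensor H K ≃ₗᵢ[ℂ] HTensor H K}
    (hX : leg12 X K ∘ᵤ leg23 H V.op.symm = leg23 H V.op.symm ∘ᵤ leg12 X K) (x' x : H) :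
    IsIntertwiner V.dual V.dual (slice (toCLM X) x' x) := by
  have hf : ∀ (T : K →L[ℂ] K) z, tmap (.id ℂ K) T (flip K K z) =
      flip K K (tmap T (.id ℂ K) z) := by
    intro T z
    have : tmap (.id ℂ K) T ∘L toCLM (flip K K) = toCLM (flip K K) ∘L tmap T (.id ℂ K) :=
      clm_ext fun x y => by simp
    exact DFunLike.congr_fun this z
  have hadj : ∀ v, (tmulL x').adjoint (leg23 H V.op.symm v) =
      V.op.symm ((tmulL x').adjoint v) :=
    adjoint_intertwines fun v => (leg23_tmul V.op.symm x' v).symm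
  have hs : ∀ z, tmap (slice (toCLM X) x' x) (.id ℂ K) (V.op.symm z) =
      V.op.symm (tmap (slice (toCLM X) x' x) (.id ℂ K) z) := by
    intro z
    have := DFunLike.congr_fun hX (tmul x z)
    simp only [LinearIsometryEquiv.trans_apply, leg23_tmul] at this
    rw [tmap_slice, tmap_slice, this, hadj]
  intro z
  obtain ⟨z, rfl⟩ := (flip K K).surjective z
  have hff : ∀ z, flip K K (flip K K z) = z := by
    have : flip K K ∘ᵤ flip K K = .refl ℂ _ := ext_tmul fun x y => by simp
    exact DFunLike.congr_fun this
  simp only [MultUnitary.dual, LinearIsometryEquiv.trans_apply, hff, hf, hs]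

end Slices

/-! ### Leg identities for right regularity, coherence and the flip. -/

section LegIdentities

variable {H₁ H₂ H₃ H₁' H₃' : Type u}
  [NormedAddCommGroup H₁] [InnerProductSpace ℂ H₁]
  [NormedAddCommGroup H₂] [InnerProductSpace ℂ H₂]
  [NormedAddCommGroup H₃] [InnerProductSpace ℂ H₃]
  [NormedAddCommGroup H₁'] [InnerProductSpace ℂ H₁']
  [NormedAddCommGroup H₃'] [InnerProductSpace ℂ H₃']

/-- `(U X)₁₃ (U' Y)₂₃ = (U × U' × 1) X₁₃ Y₂₃`. -/
theorem leg13_leg23_utensor (U : H₁ ≃ₗᵢ[ℂ] H₁) (U' : H₂ ≃ₗᵢ[ℂ] H₂)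
    (X : HTensor H₁ H₃ ≃ₗᵢ[ℂ] HTensor H₁ H₃) (Y : HTensor H₂ H₃ ≃ₗᵢ[ℂ] HTensor H₂ H₃) (z) :
    leg13 (utensor U (.refl ℂ H₃) ∘ᵤ X) H₂ (leg23 H₁ (utensor U' (.refl ℂ H₃) ∘ᵤ Y)
      (assoc H₁ H₂ H₃ z)) =
    assoc H₁ H₂ H₃ (utensor (utensor U U') (.refl ℂ H₃)
      ((assoc H₁ H₂ H₃).symm (leg13 X H₂ (leg23 H₁ Y (assoc H₁ H₂ H₃ z))))) := by
  have h1 : leg13 X H₂ ∘ᵤ leg23 H₁ (utensor U' (.refl ℂ H₃)) =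
      leg23 H₁ (utensor U' (.refl ℂ H₃)) ∘ᵤ leg13 X H₂ := by
    ext v
    have := tmap_tmap_leg13 X X (toCLM U') (.id ℂ H₃) (fun z => by simp) v
    have e : tmap (.id ℂ H₁) (tmap (toCLM U') (.id ℂ H₃)) =
        toCLM (leg23 H₁ (utensor U' (.refl ℂ H₃))) := clm_ext₃ fun x y z => by simp
    rw [e] at this
    exact this.symm
  have h2 : leg13 (utensor U (.refl ℂ H₃)) H₂ ∘ᵤ leg23 H₁ (utensor U' (.refl ℂ H₃)) ∘ᵤ
      assoc H₁ H₂ H₃ = assoc H₁ H₂ H₃ ∘ᵤ utensor (utensor U U') (.refl ℂ H₃) :=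
    ext_tmul₃' fun x y z => by simp [leg13_apply]
  rw [leg13_trans, leg23_trans]
  simp only [LinearIsometryEquiv.trans_apply]
  rw [show ∀ v, leg13 X H₂ (leg23 H₁ (utensor U' (.refl ℂ H₃)) v) =
      leg23 H₁ (utensor U' (.refl ℂ H₃)) (leg13 X H₂ v) from DFunLike.congr_fun h1]
  obtain ⟨v, hv⟩ := (assoc H₁ H₂ H₃).surjective (leg13 X H₂ (leg23 H₁ Y (assoc H₁ H₂ H₃ z)))
  rw [← hv, LinearIsometryEquiv.symm_apply_apply]
  exact DFunLike.congr_fun h2 v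

theorem leg12_utensor_refl_comm (U : H₁ ≃ₗᵢ[ℂ] H₁)
    (X : HTensor H₂ H₃ ≃ₗᵢ[ℂ] HTensor H₂ H₃) :
    leg12 (utensor U (.refl ℂ H₂)) H₃ ∘ᵤ leg23 H₁ X =
      leg23 H₁ X ∘ᵤ leg12 (utensor U (.refl ℂ H₂)) H₃ := by
  have h : leg12 (utensor U (.refl ℂ H₂)) H₃ = utensor U (.refl ℂ (HTensor H₂ H₃)) :=
    ext_tmul₃ fun x y z => by simp [leg12_tmul]
  rw [h]
  exact ext_tmul fun x y => by simp

theorem leg12_flip_leg23_flip :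
    leg12 (flip H₁ H₃) H₂ ∘ᵤ leg23 H₁ (flip H₂ H₃) ∘ᵤ assoc H₁ H₂ H₃ =
      flip (HTensor H₁ H₂) H₃ :=
  ext_tmul₃' fun x y z => by simp

end LegIdentities

theorem tmap_utensor_refl_comm {K H H' : Type u}
    [NormedAddCommGroup K] [InnerProductSpace ℂ K] [NormedAddCommGroup H] [InnerProductSpace ℂ H]
    [NormedAddCommGroup H'] [InnerProductSpace ℂ H'] {U : H ≃ₗᵢ[ℂ] H} {U' : H' ≃ₗᵢ[ℂ] H'}
    {T : H →L[ℂ] H'} (h : ∀ x, T (U x) = U' (T x)) (z : HTensor H K) :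
    tmap T (.id ℂ K) (utensor U (.refl ℂ K) z) =
      utensor U' (.refl ℂ K) (tmap T (.id ℂ K) z) := by
  have : tmap T (.id ℂ K) ∘L toCLM (utensor U (.refl ℂ K)) =
      toCLM (utensor U' (.refl ℂ K)) ∘L tmap T (.id ℂ K) := clm_ext fun x y => by simp [h]
  exact DFunLike.congr_fun this z

/-! ### Standard braided symmetries and their twists by G_V. -/

namespace NatTransR

variable {K : Type u} [NormedAddCommGroup K] [InnerProductSpace ℂ K] [CompleteSpace K]
  {V : MultUnitary K}

theorem eps_apply (η : NatTransR V) (w : Word) (z) :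
    η.eps w z = (w.obj V).op (flip (w.space V) K (η.app w z)) := rfl

theorem eps_hom (η : NatTransR V) (w : Word) :
    Word.IsHom V (w.tensor .reg) (Word.reg.tensor w) (toCLM (η.eps w)) :=
  IsCorep.isIntertwiner_braiding (H := w.space V) (w.obj V).isCorep (η.hom w)

theorem eps_natural (η : NatTransR V) (w w' : Word) (T : w.space V →L[ℂ] w'.space V)
    (hT : Word.IsHom V w w' T) (z) :
    tmap (.id ℂ K) T (η.eps w z) = η.eps w' (tmap T (.id ℂ K) z) := by
  have hf : tmap (.id ℂ K) T ∘L toCLM (flip (w.space V) K) =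
      toCLM (flip (w'.space V) K) ∘L tmap T (.id ℂ K) := clm_ext fun x y => by simp
  rw [eps_apply, eps_apply, hT, ← η.natural w w' T hT]
  exact congrArg (w'.obj V).op (DFunLike.congr_fun hf _)

theorem IsCoherent.leg12_leg23 {η : NatTransR V} (h : η.IsCoherent) (w w' : Word) (z) :
    leg12 (η.app w) (w'.space V) (leg23 (w.space V) (w'.obj V).op z) =
      leg23 (w.space V) (w'.obj V).op (leg12 (η.app w) (w'.space V) z) := by
  have hinv : ∀ v, leg23 (w.space V) (w'.obj V).op (leg23 (w.space V) (xi V w') v) = v := by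
    intro v
    simp [leg23_leg23_apply, xi]
  have hinv' : ∀ v, leg23 (w.space V) (xi V w') (leg23 (w.space V) (w'.obj V).op v) = v := by
    intro v
    simp [leg23_leg23_apply, xi]
  have := DFunLike.congr_fun (h w w') (leg23 (w.space V) (w'.obj V).op z)
  simp only [LinearIsometryEquiv.trans_apply, hinv'] at this
  rw [this, hinv]

/-- Right regularity and coherence make `ε = ξ⁻¹ θ η` compatible with tensor products. -/
theorem eps_tensor {η : NatTransR V} (hr : η.IsRightRegular) (hc : η.IsCoherent) (w w' : Word) :
    η.eps (w.tensor w') = leg12 (η.eps w) (w'.space V) ∘ᵤ leg23 (w.space V) (η.eps w') ∘ᵤ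
      assoc (w.space V) (w'.space V) K := by
  have e1 : leg12 (η.eps w) (w'.space V) = leg12 (w.obj V).op (w'.space V) ∘ᵤ
      leg12 (flip (w.space V) K) (w'.space V) ∘ᵤ leg12 (η.app w) (w'.space V) := by
    rw [← leg12_trans, ← leg12_trans]
    rfl
  have e2 : leg23 (w.space V) (η.eps w') = leg23 (w.space V) (w'.obj V).op ∘ᵤ
      leg23 (w.space V) (flip (w'.space V) K) ∘ᵤ leg23 (w.space V) (η.app w') := by
    rw [← leg23_trans, ← leg23_trans]
    rfl
  ext z
  have hz := DFunLike.congr_fun (hr w w') z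
  have hf := DFunLike.congr_fun (leg12_flip_leg23_flip (H₁ := w.space V) (H₂ := w'.space V)
    (H₃ := K)) (η.app (w.tensor w') z)
  have hl := DFunLike.congr_fun (leg23_flip_leg13 (H₂ := w'.space V) (η.app w))
    (leg23 (w.space V) (η.app w') (assoc (w.space V) (w'.space V) K z))
  rw [e1, e2, eps_apply]
  simp only [LinearIsometryEquiv.trans_apply] at hz hf hl ⊢
  -- Coherence moves W'₂₃ past η₁₂, the flip turns η₁₂ into η₁₃, right regularity recognises the
  -- component at the product, and the two flips make up the flip past the whole product. What is
  -- left is W₁₂ W'₁₃.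
  rw [hc.leg12_leg23, ← hl, ← hz, ← hf]
  simp only [corepTensor, LinearIsometryEquiv.trans_apply, leg13_apply, leg12_flip_flip]

/-- The conditions on `ε` follow from right regularity and coherence. -/
theorem definesStandard_of {η : NatTransR V} (hr : η.IsRightRegular) (hc : η.IsCoherent) :
    η.DefinesStandard :=
  ⟨⟨η.eps_hom, η.eps_natural, eps_tensor hr hc⟩, hr, hc⟩

/-- The natural transformation `(U_W × 1) η_W`, where `U_W` extends `U ∈ G_V`. -/
def twist (η : NatTransR V) {U : K ≃ₗᵢ[ℂ] K} (hU : U ∈ V.G) : NatTransR V where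
  app w := utensor (wordUnitary V U w) (.refl ℂ K) ∘ᵤ η.app w
  hom w := IsIntertwiner.trans (H := HTensor (w.space V) K) (H' := HTensor (w.space V) K)
    (H'' := HTensor (w.space V) K) (η.hom w) (isIntertwiner_utensor_refl (wordUnitary V U w))
  natural w w' T hT z := by
    simp only [LinearIsometryEquiv.trans_apply]
    rw [tmap_utensor_refl_comm (wordUnitary_natural hU hT), η.natural w w' T hT]

/-- Right regularity survives because U_{W × W'} = U_W × U_{W'}, coherence because U_W and ξ_{W'}
act on different legs. -/
theorem twist_definesStandard {η : NatTransR V} (hη : η.DefinesStandard) {U : K ≃ₗᵢ[ℂ] K}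
    (hU : U ∈ V.G) : (η.twist hU).DefinesStandard := by
  refine definesStandard_of (fun w w' => ?_) (fun w w' => ?_)
  · ext z
    have := DFunLike.congr_fun (hη.rightRegular w w') z
    simp only [LinearIsometryEquiv.trans_apply] at this
    have h := leg13_leg23_utensor (wordUnitary V U w) (wordUnitary V U w') (η.app w) (η.app w') z
    rw [← this, LinearIsometryEquiv.symm_apply_apply] at h
    exact h.symm
  · have h1 := hη.coherent w w'
    have h2 := leg12_utensor_refl_comm (wordUnitary V U w) (xi V w')
    simp only [twist, leg12_trans]
    ext z
    have h1z := DFunLike.congr_fun h1 z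
    have h2z := DFunLike.congr_fun h2 (leg12 (η.app w) (w'.space V) z)
    simp only [LinearIsometryEquiv.trans_apply] at h1z h2z ⊢
    rw [h1z, h2z]

/-! ### Comparing two standard braided symmetries. -/

section Comparison

variable {η η' : NatTransR V}

/-- The slices of η'_W η_W⁻¹ lie in (V, V) by the arrow property and in (V^d, V^d) by coherence with
W' = V, hence are scalar. -/
theorem exists_app_eq_utensor [Nontrivial K] (hV : V.WeaklyIrreducible) (hη : η.DefinesStandard)
    (hη' : η'.DefinesStandard) (w : Word) :
    ∃ U : w.space V ≃ₗᵢ[ℂ] w.space V,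
      η'.app w = utensor U (.refl ℂ K) ∘ᵤ η.app w := by
  have h1 : IsIntertwiner (corepTensor (.refl ℂ (HTensor K (w.space V))) V.op)
      (corepTensor (.refl ℂ (HTensor K (w.space V))) V.op)
      (toCLM (η'.app w ∘ᵤ (η.app w).symm)) :=
    IsIntertwiner.trans (H := HTensor (w.space V) K) (H' := HTensor (w.space V) K)
      (H'' := HTensor (w.space V) K) (IsIntertwiner.symm (H := HTensor (w.space V) K)
        (H' := HTensor (w.space V) K) (η.hom w)) (η'.hom w)
  have h2 : leg12 (η'.app w ∘ᵤ (η.app w).symm) K ∘ᵤ leg23 (w.space V) V.op.symm =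
      leg23 (w.space V) V.op.symm ∘ᵤ leg12 (η'.app w ∘ᵤ (η.app w).symm) K := by
    have c := hη.coherent w .reg
    have c' := hη'.coherent w .reg
    have hs : ∀ v, leg12 (η.app w).symm K (leg12 (η.app w) K v) = v := by
      intro v
      have := DFunLike.congr_fun (leg12_trans (H₃ := K) (η.app w) (η.app w).symm) v
      simpa using this.symm
    rw [leg12_trans]
    ext z
    obtain ⟨z, rfl⟩ := (leg12 (η.app w) K).surjective z
    have cz := DFunLike.congr_fun c z
    have cz' := DFunLike.congr_fun c' z
    simp only [LinearIsometryEquiv.trans_apply] at cz cz' ⊢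
    rw [hs]
    refine Eq.trans ?_ cz'
    refine congrArg (leg12 (η'.app w) K) ?_
    exact (congrArg (leg12 (η.app w).symm K) cz.symm).trans (hs _)
  obtain ⟨U, hU⟩ := exists_eq_utensor_of_slices (η'.app w ∘ᵤ (η.app w).symm) fun x' x => by
    have hm : slice (toCLM (η'.app w ∘ᵤ (η.app w).symm)) x' x ∈
        {T : K →L[ℂ] K | IsIntertwiner V.op V.op T} ∩ {T | IsIntertwiner V.dual V.dual T} :=
      ⟨isIntertwiner_slice h1 x' x, isIntertwiner_dual_slice h2 x' x⟩
    rw [hV] at hm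
    exact hm
  refine ⟨U, ?_⟩
  rw [← hU]
  ext z
  simp

/-- Two standard braided symmetries differ by an element of `G_V`. -/
theorem exists_app_eq_wordUnitary [Nontrivial K] (hV : V.WeaklyIrreducible)
    (hη : η.DefinesStandard) (hη' : η'.DefinesStandard) :
    ∃ U ∈ V.G, ∀ w : Word, η'.app w = utensor (wordUnitary V U w) (.refl ℂ K) ∘ᵤ η.app w := by
  choose Us hUs using exists_app_eq_utensor hV hη hη'
  -- Evaluate naturality of `η'` at the preimage of x ⊗ y under η_W with y ≠ 0, then cancel y.
  have hnat : ∀ (w w' : Word) (T : w.space V →L[ℂ] w'.space V), Word.IsHom V w w' T →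
      ∀ x, T (Us w x) = Us w' (T x) := by
    intro w w' T hT x
    obtain ⟨y, hy⟩ := exists_ne (0 : K)
    obtain ⟨z, hz⟩ := (η.app w).surjective (tmul x y)
    have h := η'.natural w w' T hT z
    rw [hUs, hUs] at h
    simp only [LinearIsometryEquiv.trans_apply] at h
    rw [← η.natural w w' T hT, hz] at h
    simp only [utensor_tmul, tmap_tmul] at h
    exact tmul_left_injective hy h
  have htensor : ∀ w w', Us (w.tensor w') = utensor (Us w) (Us w') := by
    intro w w'
    refine utensor_refl_injective (H' := K) ?_
    ext z
    obtain ⟨z, rfl⟩ := (η.app (w.tensor w')).surjective z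
    have h := DFunLike.congr_fun (hη.rightRegular w w') z
    have h' := DFunLike.congr_fun (hη'.rightRegular w w') z
    rw [hUs, hUs, hUs] at h'
    simp only [LinearIsometryEquiv.trans_apply] at h h'
    have e := leg13_leg23_utensor (Us w) (Us w') (η.app w) (η.app w') z
    rw [← h, LinearIsometryEquiv.symm_apply_apply] at e
    exact (assoc (w.space V) (w'.space V) K).injective (h'.trans e)
  -- For the unit vector e, the arrow · ⊗ e from the unit to its square gives Ue ⊗ e = Ue ⊗ Ue. As
  -- Ue ≠ 0, this rules out a phase.
  have hunit : Us .one unitVec = unitVec := by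
    have h := hnat .one (Word.one.tensor .one) (tmulL.flip unitVec)
      (isIntertwiner_tmulL_flip unitVec) unitVec
    rw [htensor] at h
    have h' : tmul (Us .one unitVec) unitVec = tmul (Us .one unitVec) (Us .one unitVec) :=
      h.trans (utensor_tmul _ _ _ _)
    have h0 : ‖tmul (Us .one unitVec) (Us .one unitVec - unitVec)‖ = 0 := by
      rw [norm_eq_zero]
      have := (tmulL (Us .one unitVec)).map_sub (Us .one unitVec) unitVec
      simp only [tmulL_apply] at this
      rw [this, h', sub_self]
    rw [norm_tmul, LinearIsometryEquiv.norm_map, norm_unitVec, one_mul, norm_eq_zero,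
      sub_eq_zero] at h0
    exact h0
  have hone : Us .one = .refl ℂ _ := by
    refine LinearIsometryEquiv.ext fun x => ?_
    rw [eq_smul_unitVec x, map_smul, hunit]
    rfl
  have htriv : ∀ w, Us (.triv w) = .refl ℂ _ := by
    refine fun w => LinearIsometryEquiv.ext fun x => ?_
    have h := hnat .one (.triv w) ((EuclideanSpace.proj PUnit.unit :
      EuclideanSpace ℂ PUnit.{u + 1} →L[ℂ] ℂ).smulRight x) (isIntertwiner_refl _) unitVec
    have e : (EuclideanSpace.proj PUnit.unit : EuclideanSpace ℂ PUnit.{u + 1} →L[ℂ] ℂ).smulRight x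
        unitVec = x := by simp [unitVec]
    rw [hunit, e] at h
    exact h.symm
  have hword : ∀ w, Us w = wordUnitary V (Us .reg) w := by
    intro w
    induction w with
    | one => exact hone
    | reg => rfl
    | triv w => exact htriv w
    | tensor w w' ih ih' =>
      rw [htensor, ih, ih']
      rfl
  refine ⟨Us .reg, fun r s T hT z => ?_, fun w => by rw [← hword, hUs]⟩
  rw [← wordUnitary_power, ← wordUnitary_power, ← hword, ← hword]
  exact hnat _ _ T hT z

end Comparison

end NatTransR

/-- If K = 0, positive tensor powers vanish, and on the zeroth power U acts as the identity by
definition. -/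
theorem MultUnitary.mem_G_of_subsingleton {K : Type u} [NormedAddCommGroup K]
    [InnerProductSpace ℂ K] [CompleteSpace K] [Subsingleton K] (V : MultUnitary K)
    (U : K ≃ₗᵢ[ℂ] K) : U ∈ V.G := by
  have h : ∀ r z, V.upower U r z = z := by
    rintro (_ | r) z
    · rfl
    · exact (subsingleton_hTensor (H := (power r).space V) (H' := K)).elim _ _
  intro r s T _ z
  rw [h, h]

end MulUnitary

end

theorem theorem2p8 {K : Type*} [NormedAddCommGroup K] [InnerProductSpace ℂ K] [CompleteSpace K]
    (V : MulUnitary.MultUnitary K) (hV : V.WeaklyIrreducible) :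
    (∀ η η' : MulUnitary.NatTransR V, η.DefinesStandard → η'.DefinesStandard →
      ∃! U : K ≃ₗᵢ[ℂ] K, U ∈ V.G ∧
        η'.atV = MulUnitary.ucomp (MulUnitary.utensor U (.refl ℂ K)) η.atV) ∧
    (∀ U ∈ V.G, ∀ η : MulUnitary.NatTransR V, η.DefinesStandard →
      ∃! η' : MulUnitary.NatTransR V, η'.DefinesStandard ∧
        η'.atV = MulUnitary.ucomp (MulUnitary.utensor U (.refl ℂ K)) η.atV) := by
  rcases subsingleton_or_nontrivial K with hK | hK
  · have hsub : ∀ w : MulUnitary.Word, Subsingleton (MulUnitary.HTensor (w.space V) K) :=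
      fun w => MulUnitary.subsingleton_hTensor
    have happ : ∀ (w : MulUnitary.Word)
        (A B : MulUnitary.HTensor (w.space V) K ≃ₗᵢ[ℂ] MulUnitary.HTensor (w.space V) K),
        A = B := fun w A B => LinearIsometryEquiv.ext fun z => (hsub w).elim _ _
    refine ⟨fun η η' _ _ => ⟨.refl ℂ K, ⟨V.mem_G_of_subsingleton _, happ .reg _ _⟩,
      fun U _ => LinearIsometryEquiv.ext fun z => hK.elim _ _⟩,
      fun U _ η hη => ⟨η, ⟨hη, happ .reg _ _⟩, fun η' _ => ?_⟩⟩
    exact MulUnitary.NatTransR.ext (funext fun w => happ w _ _)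
  -- η_V is surjective, so it cancels on the right, and U × 1 determines U because K ≠ 0.
  · have cancel : ∀ (η : MulUnitary.NatTransR V) (U U' : K ≃ₗᵢ[ℂ] K),
        MulUnitary.ucomp (MulUnitary.utensor U (.refl ℂ K)) η.atV =
          MulUnitary.ucomp (MulUnitary.utensor U' (.refl ℂ K)) η.atV → U = U' := by
      intro η U U' h
      refine MulUnitary.utensor_refl_injective (H' := K) (LinearIsometryEquiv.ext fun z => ?_)
      obtain ⟨z, rfl⟩ := η.atV.surjective z
      exact DFunLike.congr_fun h z
    refine ⟨fun η η' hη hη' => ?_, fun U hU η hη =>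
      ⟨η.twist hU, ⟨MulUnitary.NatTransR.twist_definesStandard hη hU, rfl⟩, ?_⟩⟩
    · obtain ⟨U, hU, h⟩ := MulUnitary.NatTransR.exists_app_eq_wordUnitary hV hη hη'
      exact ⟨U, ⟨hU, h .reg⟩, fun U' hU' => cancel η U' U (hU'.2.symm.trans (h .reg))⟩
    · rintro η' ⟨hη', he⟩
      -- By the first half any solution is a twist of `η` by some U'; comparing components at V
      -- gives U' = U, hence equality on every object.
      obtain ⟨U', _, h⟩ := MulUnitary.NatTransR.exists_app_eq_wordUnitary hV hη hη'
      obtain rfl := cancel η U' U ((h .reg).symm.trans he)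
      exact MulUnitary.NatTransR.ext (funext h)
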